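/- Let $k$ be a field and let $\Lambda$ be a finite dimensional associative unital $k$-algebra, with enveloping algebra $\Lambda^{\mathrm e}=\Lambda\otimes_k\Lambda^{\mathrm{op}}$, over which $\Lambda$ is a left module via $(a\otimes b)\cdot x=axb$ (the regular bimodule). Modules are left modules. For a module $M$ over a left perfect ring $R$, the syzygy $\Omega_R(M)$ is the kernel of a projective cover of $M$, $\Omega_R^0(M)=M$ and $\Omega_R^{n+1}(M)=\Omega_R(\Omega_R^{n}(M))$. A module $N$ is periodic if $\Omega_R^p(N)\cong N$ for some $p>0$, and $M$ is eventually periodic if $\Omega_R^n(M)$ is periodic for some $n\ge 0$. The algebra $\Lambda$ is called eventually periodic if it is eventually periodic as a $\Lambda^{\mathrm e}$-module. A (two-sided) Noetherian ring $R$ is called Gorenstein if $\operatorname{inj.dim}_R R<\infty$ and $\operatorname{inj.dim}_{R^{\mathrm{op}}}R<\infty$. A finitely generated $R$-module $X$ is totally reflexive if the evaluation map $X\to X^{**}$ is bijective and $\operatorname{Ext}^i_R(X,R)=0=\operatorname{Ext}^i_{R^{\mathrm{op}}}(X^*,R)$ for all $i>0$, where $(-)^*=\operatorname{Hom}(-,R)$.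 The Gorenstein dimension $\operatorname{G-dim}_R M\in\mathbb N\cup\{\infty\}$ of a finitely generated $R$-module $M$ is the infimum of the lengths $n\ge 0$ of exact sequences $0\to X_n\to\cdots\to X_0\to M\to 0$ with all $X_i$ totally reflexive. **Theorem.** Let $\Lambda$ be an eventually periodic finite dimensional $k$-algebra. Then $\Lambda$ is Gorenstein if and only if $\operatorname{G-dim}_{\Lambda^{\mathrm e}}\Lambda<\infty$. In this case, $\operatorname{G-dim}_{\Lambda^{\mathrm e}}\Lambda=\operatorname{inj.dim}_\Lambda\Lambda$. (If $\Lambda=0$, both dimensions are understood to be $0$.) -/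

import Mathlib

open scoped TensorProduct

universe u v

/-! All modules are left modules; a right `R`-module is a module over `Rᵐᵒᵖ`. -/

section Syzygies

variable (R : Type u) [Ring R]

/-- A projective cover of `M`: a surjection from a projective module whose kernel is superfluous. -/
structure IsProjectiveCover {P M : Type u} [AddCommGroup P] [Module R P]
    [AddCommGroup M] [Module R M] (f : P →ₗ[R] M) : Prop where
  projective : Module.Projective R P
  surjective : Function.Surjective f
  superfluous_ker : ∀ N : Submodule R P, N ⊔ LinearMap.ker f = ⊤ → N = ⊤

/-- `N` is (isomorphic to) the syzygy `Ω_R(M)`: the kernel of a projective cover of `M`. -/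
def IsSyzygy (M N : Type u) [AddCommGroup M] [Module R M] [AddCommGroup N] [Module R N] : Prop :=
  ∃ (P : Type u) (_ : AddCommGroup P) (_ : Module R P) (f : P →ₗ[R] M),
    IsProjectiveCover R f ∧ Nonempty (N ≃ₗ[R] LinearMap.ker f)

/-- `N` is (isomorphic to) the `n`-th syzygy `Ω_R^n(M)`, where `Ω_R^0(M) = M` and
`Ω_R^{n+1}(M) = Ω_R(Ω_R^n(M))`. -/
def IsNthSyzygy : ℕ → ∀ (M N : Type u) [AddCommGroup M] [Module R M]
    [AddCommGroup N] [Module R N], Prop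
  | 0, M, N, _, _, _, _ => Nonempty (N ≃ₗ[R] M)
  | n + 1, M, N, _, _, _, _ =>
      ∃ (K : Type u) (_ : AddCommGroup K) (_ : Module R K), IsNthSyzygy n M K ∧ IsSyzygy R K N

/-- `M` is periodic: `Ω_R^p(M) ≅ M` for some `p > 0`. -/
def IsPeriodicModule (M : Type u) [AddCommGroup M] [Module R M] : Prop :=
  ∃ p : ℕ, 0 < p ∧ IsNthSyzygy R p M M

/-- `M` is eventually periodic: `Ω_R^n(M)` is periodic for some `n ≥ 0`. -/
def IsEventuallyPeriodicModule (M : Type u) [AddCommGroup M] [Module R M] : Prop :=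
  ∃ (n : ℕ) (N : Type u) (_ : AddCommGroup N) (_ : Module R N),
    IsNthSyzygy R n M N ∧ IsPeriodicModule R N

end Syzygies

section GorensteinDimension

open CategoryTheory

variable (R : Type u) [Ring R]

/-- The evaluation map `M → M**`, `m ↦ (f ↦ f m)`, where `M* = Hom_R(M, R)` is a right `R`-module
and `M** = Hom_{Rᵒᵖ}(M*, R)`. -/
def bidualEval (M : Type u) [AddCommGroup M] [Module R M] :
    M →ₗ[R] ((M →ₗ[R] R) →ₗ[Rᵐᵒᵖ] R) where
  toFun m :=
    { toFun := fun f => f m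
      map_add' := fun _ _ => rfl
      map_smul' := fun _ _ => rfl }
  map_add' m m' := by ext f; exact map_add f m m'
  map_smul' r m := by ext f; exact map_smul f r m

/-- Totally reflexive modules: `M` is finitely generated and reflexive, `Ext_R^i(M, R) = 0` and
`Ext_{Rᵒᵖ}^i(M*, R) = 0` for all `i > 0`. -/
structure IsTotallyReflexive (M : Type u) [AddCommGroup M] [Module R M] : Prop where
  finite : Module.Finite R M
  reflexive : Function.Bijective (bidualEval R M)
  ext_eq_zero : ∀ i : ℕ, 0 < i →
    Subsingleton (Abelian.Ext.{u} (ModuleCat.of R M) (ModuleCat.of R R) i)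
  ext_dual_eq_zero : ∀ i : ℕ, 0 < i →
    Subsingleton (Abelian.Ext.{u} (ModuleCat.of Rᵐᵒᵖ (M →ₗ[R] R)) (ModuleCat.of Rᵐᵒᵖ R) i)

/-- There is an exact sequence `0 → X_n → ⋯ → X_1 → X_0 → M → 0` with every `X_i` totally
reflexive (the sequence is continued by zero modules to the left of `X_n`). -/
def HasTotallyReflexiveResolution (M : Type u) [AddCommGroup M] [Module R M] (n : ℕ) : Prop :=
  ∃ (X : ℕ → ModuleCat.{u} R) (d : ∀ i, X (i + 1) →ₗ[R] X i) (ε : X 0 →ₗ[R] M),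
    (∀ i, IsTotallyReflexive R (X i)) ∧ (∀ i, n < i → Subsingleton (X i)) ∧
    Function.Surjective ε ∧ Function.Exact (d 0) ε ∧ ∀ i, Function.Exact (d (i + 1)) (d i)

/-- The Gorenstein dimension `G-dim_R M`: the infimum of the lengths `n` of resolutions of `M` by
totally reflexive modules (`⊤` if there is none). -/
noncomputable def gorensteinDim (M : Type u) [AddCommGroup M] [Module R M] : ℕ∞ :=
  ⨅ (n : ℕ) (_ : HasTotallyReflexiveResolution R M n), (n : ℕ∞)

/-- The injective dimension as an element of `ℕ∞`: Mathlib's injective dimension, except that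
the zero module gets the value `0` in place of `⊥`. -/
noncomputable def injDim (M : Type u) [AddCommGroup M] [Module R M] : ℕ∞ :=
  (injectiveDimension (ModuleCat.of R M)).unbotD 0

/-- (Iwanaga-)Gorenstein rings: two-sided Noetherian rings of finite injective dimension as a left
and as a right module over themselves. -/
structure IsGorensteinRing : Prop where
  noetherian_left : IsNoetherianRing R
  noetherian_right : IsNoetherianRing Rᵐᵒᵖ
  injDim_left : injDim R R < ⊤
  injDim_right : injDim Rᵐᵒᵖ R < ⊤

end GorensteinDimension

section Bimodules

variable (k : Type v) [Field k] (Λ : Type u) [Ring Λ] [Algebra k Λ]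

/-- The enveloping algebra `Λᵉ = Λ ⊗ₖ Λᵒᵖ`. -/
abbrev EnvelopingAlgebra : Type u := Λ ⊗[k] Λᵐᵒᵖ

/-- The regular bimodule: `Λ` as a left module over `Λᵉ`. -/
abbrev regularBimodule : Module (EnvelopingAlgebra k Λ) Λ := TensorProduct.Algebra.module

theorem regularBimodule_smul (a b x : Λ) :
    letI := regularBimodule k Λ
    (a ⊗ₜ[k] MulOpposite.op b : EnvelopingAlgebra k Λ) • x = a * x * b := by
  simp [TensorProduct.Algebra.smul_def, mul_assoc]

/-- `Λ` is an eventually periodic algebra: the regular bimodule is eventually periodic over `Λᵉ`. -/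
def IsEventuallyPeriodicAlgebra : Prop :=
  letI := regularBimodule k Λ
  IsEventuallyPeriodicModule (EnvelopingAlgebra k Λ) Λ

/-- The Gorenstein dimension `G-dim_{Λᵉ} Λ` of the regular bimodule. -/
noncomputable def bimoduleGorensteinDim : ℕ∞ :=
  letI := regularBimodule k Λ
  gorensteinDim (EnvelopingAlgebra k Λ) Λ

end Bimodules

/-!
Write `E = Λᵉ` and let `X j` be the syzygies of the regular bimodule `Λ`, with short exact sequences
`0 → X (j + 1) → P j → X j → 0` where `P j` is a finitely generated projective bimodule.

**From bimodules to left modules.** Every `X j` is projective as a left module, so applying the left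
dual `Hom_Λ(-, Λ)` gives short exact sequences `0 → C j → I j → C (j + 1) → 0` of left modules with
`C 0 = Λ`. By the adjunction `Hom_Λ(M, Hom_Λ(P, Λ)) = Hom_E(P, Hom_k(M, Λ))` (`toScalarHom`,
`ofScalarHom`) the modules `I j` are injective, so this is an injective coresolution of `Λ`, and it
is eventually periodic when the `X j` are. In particular `inj.dim Λ ≤ j` if and only if `C j` is
injective (`hasInjectiveDimensionLT_iff_leftDual_injective`). For `M = D(Λ)` the bimodule
`Hom_k(M, Λ)` is `E` itself, and the adjunction identifies `Ext_E^i(Λ, E)` with `Ext_Λ^i(D(Λ), Λ)`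
as far as vanishing is concerned (`ext_enveloping_iff`).

**Finiteness.** A resolution of `Λ` of length `g` by totally reflexive bimodules gives
`Ext_E^i(Λ, E) = 0`, hence `Ext_Λ^i(D(Λ), Λ) = 0`, for `i > g`. The injective modules `I j` are
direct summands of powers of `D(Λ)`, so dimension shifting gives `Ext_Λ^i(C j, Λ) = 0` for
`i > g + j`. By periodicity `C j` is isomorphic to some `C n` with `j` much larger than `n`, whence
`Ext_Λ^1(C j, C (j - 1)) = Ext_Λ^j(C j, Λ) = 0`; the coresolution splits there and `C j` is
injective (`exists_leftDual_injective`). The same argument applies to `Λᵐᵒᵖ`, which has the same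
bimodules.

**The value.** If `inj.dim Λ = d` is finite, then `Ext_E^i(Λ, E) = 0` for `i > d`. Modules which
recur as arbitrarily high syzygies of themselves, with all syzygies left orthogonal to the ring, are
totally reflexive (`IsTotallyReflexive.of_recurrent`), and total reflexivity descends from
`X (j + 1)` to `X j` as long as `j ≥ d` (`IsTotallyReflexive.of_syzygy`); so `X d` is totally
reflexive and the Gorenstein dimension is at most `d`. Conversely, if there is a resolution of
length `g < d`, then the vanishing of `Ext_Λ^i(D(Λ), Λ)` for `i > g` splits the coresolution from
the injective module `C d` down to `C g`, which is impossible
(`leftDual_injective_of_ext_vanishing`).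
-/

/-! ### Vanishing of `Ext` along short exact sequences of modules -/

section ExtVanishing

open CategoryTheory

variable {R : Type u} [Ring R]

/-- `0 → A → B → C → 0` is a short exact sequence of modules, with maps `f` and `g`. -/
structure IsShortExact {A B C : Type u} [AddCommGroup A] [Module R A] [AddCommGroup B] [Module R B]
    [AddCommGroup C] [Module R C] (f : A →ₗ[R] B) (g : B →ₗ[R] C) : Prop where
  injective : Function.Injective f
  exact : Function.Exact f g
  surjective : Function.Surjective g

namespace IsShortExact

variable {A B C : ModuleCat.{u} R} {f : A →ₗ[R] B} {g : B →ₗ[R] C}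

theorem shortExact (h : IsShortExact f g) :
    (ModuleCat.shortComplexOfCompEqZero f g h.exact.linearMap_comp_eq_zero).ShortExact :=
  ModuleCat.shortComplex_shortExact _ h.exact h.injective h.surjective

/-- `Ext^(i+1)(C, Y) = 0` if `Ext^(i+1)(B, Y) = 0` and `Ext^i(A, Y) = 0`. -/
theorem ext_right (h : IsShortExact f g) {Y : ModuleCat.{u} R} {i : ℕ}
    (hB : Subsingleton (Abelian.Ext.{u} B Y (i + 1))) (hA : Subsingleton (Abelian.Ext.{u} A Y i)) :
    Subsingleton (Abelian.Ext.{u} C Y (i + 1)) := by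
  refine subsingleton_of_forall_eq 0 fun x => ?_
  obtain ⟨y, rfl⟩ := Abelian.Ext.contravariant_sequence_exact₃ h.shortExact Y x
    (hB.elim _ _) (add_comm 1 i)
  rw [hA.elim y 0, Abelian.Ext.comp_zero]

/-- `Ext^i(A, Y) = 0` if `Ext^i(B, Y) = 0` and `Ext^(i+1)(C, Y) = 0`. -/
theorem ext_left (h : IsShortExact f g) {Y : ModuleCat.{u} R} {i : ℕ}
    (hB : Subsingleton (Abelian.Ext.{u} B Y i)) (hC : Subsingleton (Abelian.Ext.{u} C Y (i + 1))) :
    Subsingleton (Abelian.Ext.{u} A Y i) := by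
  refine subsingleton_of_forall_eq 0 fun x => ?_
  obtain ⟨y, rfl⟩ := Abelian.Ext.contravariant_sequence_exact₁ h.shortExact Y x
    (add_comm 1 i) (hC.elim _ _)
  rw [hB.elim y 0, Abelian.Ext.comp_zero]

/-- `Ext^(i+1)(X, A) = 0` if `Ext^(i+1)(X, B) = 0` and `Ext^i(X, C) = 0`. -/
theorem ext_left_of_right (h : IsShortExact f g) {X : ModuleCat.{u} R} {i : ℕ}
    (hB : Subsingleton (Abelian.Ext.{u} X B (i + 1))) (hC : Subsingleton (Abelian.Ext.{u} X C i)) :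
    Subsingleton (Abelian.Ext.{u} X A (i + 1)) := by
  refine subsingleton_of_forall_eq 0 fun x => ?_
  obtain ⟨y, rfl⟩ := Abelian.Ext.covariant_sequence_exact₁ X h.shortExact x (hB.elim _ _) rfl
  rw [hC.elim y 0, Abelian.Ext.zero_comp]

/-- `Ext^i(X, C) = 0` if `Ext^i(X, B) = 0` and `Ext^(i+1)(X, A) = 0`. -/
theorem ext_right_of_left (h : IsShortExact f g) {X : ModuleCat.{u} R} {i : ℕ}
    (hB : Subsingleton (Abelian.Ext.{u} X B i)) (hA : Subsingleton (Abelian.Ext.{u} X A (i + 1))) :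
    Subsingleton (Abelian.Ext.{u} X C i) := by
  refine subsingleton_of_forall_eq 0 fun x => ?_
  obtain ⟨y, rfl⟩ := Abelian.Ext.covariant_sequence_exact₃ X h.shortExact x rfl (hA.elim _ _)
  rw [hB.elim y 0, Abelian.Ext.zero_comp]

theorem exists_extension (h : IsShortExact f g) {Y : ModuleCat.{u} R}
    (hC : Subsingleton (Abelian.Ext.{u} C Y 1)) (φ : A →ₗ[R] Y) :
    ∃ ψ : B →ₗ[R] Y, ψ ∘ₗ f = φ := by
  obtain ⟨y, hy⟩ := Abelian.Ext.contravariant_sequence_exact₁ h.shortExact Y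
    (Abelian.Ext.mk₀ (ModuleCat.ofHom φ)) (add_zero 1) (hC.elim _ _)
  obtain ⟨ψ, rfl⟩ := (Abelian.Ext.mk₀_bijective B Y).surjective y
  refine ⟨ψ.hom, ?_⟩
  rw [Abelian.Ext.mk₀_comp_mk₀] at hy
  exact congrArg ModuleCat.Hom.hom ((Abelian.Ext.mk₀_bijective _ _).injective hy)

theorem ext_one_of_extension (h : IsShortExact f g) {Y : ModuleCat.{u} R}
    (hB : Subsingleton (Abelian.Ext.{u} B Y 1))
    (hext : ∀ φ : A →ₗ[R] Y, ∃ ψ : B →ₗ[R] Y, ψ ∘ₗ f = φ) :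
    Subsingleton (Abelian.Ext.{u} C Y 1) := by
  refine subsingleton_of_forall_eq 0 fun x => ?_
  obtain ⟨y, rfl⟩ := Abelian.Ext.contravariant_sequence_exact₃ h.shortExact Y x
    (hB.elim _ _) (add_zero 1)
  obtain ⟨φ, rfl⟩ := (Abelian.Ext.mk₀_bijective A Y).surjective y
  obtain ⟨ψ, hψ⟩ := hext φ.hom
  have : φ = ModuleCat.ofHom f ≫ ModuleCat.ofHom ψ := by
    ext x
    exact (LinearMap.congr_fun hψ x).symm
  rw [this, ← Abelian.Ext.mk₀_comp_mk₀]
  exact h.shortExact.extClass_comp_assoc _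

theorem exists_lift (h : IsShortExact f g) {X : ModuleCat.{u} R}
    (hA : Subsingleton (Abelian.Ext.{u} X A 1)) (φ : X →ₗ[R] C) :
    ∃ ψ : X →ₗ[R] B, g ∘ₗ ψ = φ := by
  obtain ⟨y, hy⟩ := Abelian.Ext.covariant_sequence_exact₃ X h.shortExact
    (Abelian.Ext.mk₀ (ModuleCat.ofHom φ)) (zero_add 1) (hA.elim _ _)
  obtain ⟨ψ, rfl⟩ := (Abelian.Ext.mk₀_bijective X B).surjective y
  refine ⟨ψ.hom, ?_⟩
  rw [Abelian.Ext.mk₀_comp_mk₀] at hy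
  exact congrArg ModuleCat.Hom.hom ((Abelian.Ext.mk₀_bijective _ _).injective hy)

theorem ext_one_of_lift (h : IsShortExact f g) {X : ModuleCat.{u} R}
    (hB : Subsingleton (Abelian.Ext.{u} X B 1))
    (hlift : ∀ φ : X →ₗ[R] C, ∃ ψ : X →ₗ[R] B, g ∘ₗ ψ = φ) :
    Subsingleton (Abelian.Ext.{u} X A 1) := by
  refine subsingleton_of_forall_eq 0 fun x => ?_
  obtain ⟨y, rfl⟩ := Abelian.Ext.covariant_sequence_exact₁ X h.shortExact x
    (hB.elim _ _) (zero_add 1)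
  obtain ⟨φ, rfl⟩ := (Abelian.Ext.mk₀_bijective X C).surjective y
  obtain ⟨ψ, hψ⟩ := hlift φ.hom
  have : φ = ModuleCat.ofHom ψ ≫ ModuleCat.ofHom g := by
    ext x
    exact (LinearMap.congr_fun hψ x).symm
  rw [this, ← Abelian.Ext.mk₀_comp_mk₀,
    Abelian.Ext.comp_assoc_of_second_deg_zero]
  erw [h.shortExact.comp_extClass]
  rw [Abelian.Ext.comp_zero]

end IsShortExact

theorem ext_subsingleton_of_projective {P Y : ModuleCat.{u} R} (hP : Module.Projective R P) {i : ℕ}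
    (hi : 0 < i) : Subsingleton (Abelian.Ext.{u} P Y i) := by
  obtain ⟨i, rfl⟩ := Nat.exists_eq_succ_of_ne_zero hi.ne'
  have : Projective P := (IsProjective.iff_projective P).1 hP
  exact Abelian.Ext.subsingleton_of_projective P Y i

theorem ext_subsingleton_of_injective {X I : ModuleCat.{u} R} (hI : Module.Injective R I) {i : ℕ}
    (hi : 0 < i) : Subsingleton (Abelian.Ext.{u} X I i) := by
  obtain ⟨i, rfl⟩ := Nat.exists_eq_succ_of_ne_zero hi.ne'
  have : Injective I := (Module.injective_iff_injective_object R I).1 hI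
  exact Abelian.Ext.subsingleton_of_injective X I i

/-- `Ext` vanishing in the first variable passes to direct summands. -/
theorem ext_subsingleton_of_retract {X X' Y : ModuleCat.{u} R} (s : X →ₗ[R] X') (r : X' →ₗ[R] X)
    (hrs : r ∘ₗ s = LinearMap.id) {i : ℕ} (h : Subsingleton (Abelian.Ext.{u} X' Y i)) :
    Subsingleton (Abelian.Ext.{u} X Y i) := by
  refine subsingleton_of_forall_eq 0 fun x => ?_
  have : ModuleCat.ofHom s ≫ ModuleCat.ofHom r = 𝟙 X := by
    ext x
    exact LinearMap.congr_fun hrs x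
  rw [← x.mk₀_id_comp, ← this, ← Abelian.Ext.mk₀_comp_mk₀_assoc,
    h.elim ((Abelian.Ext.mk₀ (ModuleCat.ofHom r)).comp x (zero_add i)) 0, Abelian.Ext.comp_zero]

theorem ext_subsingleton_congr {X X' Y : ModuleCat.{u} R} (e : X ≃ₗ[R] X') {i : ℕ}
    (h : Subsingleton (Abelian.Ext.{u} X' Y i)) : Subsingleton (Abelian.Ext.{u} X Y i) :=
  ext_subsingleton_of_retract e.toLinearMap e.symm.toLinearMap (by ext; simp) h

/-- `Ext` vanishing in the first variable passes to finite powers. -/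
theorem ext_subsingleton_pi {ι : Type} [Fintype ι] [DecidableEq ι] {X Y : ModuleCat.{u} R}
    {i : ℕ}
    (h : Subsingleton (Abelian.Ext.{u} X Y i)) :
    Subsingleton (Abelian.Ext.{u} (ModuleCat.of R (ι → X)) Y i) := by
  refine subsingleton_of_forall_eq 0 fun x => ?_
  -- The identity of `X ^ ι` is the sum of the idempotents belonging to the coordinates.
  have key : 𝟙 (ModuleCat.of R (ι → X)) =
      ∑ t : ι, ModuleCat.ofHom (LinearMap.proj t : (ι → X) →ₗ[R] X) ≫
        ModuleCat.ofHom (LinearMap.single R (fun _ : ι => X) t) := by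
    apply ModuleCat.hom_ext
    rw [ModuleCat.hom_sum]
    ext a b c
    simp [Finset.sum_apply, Pi.single_apply]
  rw [← x.mk₀_id_comp, key, Abelian.Ext.mk₀_sum, Abelian.Ext.sum_comp]
  refine Finset.sum_eq_zero fun t _ => ?_
  rw [← Abelian.Ext.mk₀_comp_mk₀_assoc, h.elim (Abelian.Ext.comp _ x _) 0,
    Abelian.Ext.comp_zero]

end ExtVanishing

/-! ### Totally reflexive modules -/

section TotallyReflexive

open CategoryTheory

variable {R : Type u} [Ring R]

section Dual

variable {M N L : Type u} [AddCommGroup M] [Module R M] [AddCommGroup N] [Module R N]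
  [AddCommGroup L] [Module R L]

/-- The transpose `N* → M*` of a linear map `M → N`, as a map of right `R`-modules. -/
def rightTranspose (f : M →ₗ[R] N) : (N →ₗ[R] R) →ₗ[Rᵐᵒᵖ] (M →ₗ[R] R) where
  toFun φ := φ ∘ₗ f
  map_add' _ _ := rfl
  map_smul' _ _ := rfl

@[simp]
theorem rightTranspose_apply (f : M →ₗ[R] N) (φ : N →ₗ[R] R) :
    rightTranspose f φ = φ ∘ₗ f := rfl

@[simp]
theorem bidualEval_apply (m : M) (φ : M →ₗ[R] R) : bidualEval R M m φ = φ m := rfl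

/-- The evaluation map is natural. -/
theorem bidualEval_map (f : M →ₗ[R] N) (m : M) :
    bidualEval R N (f m) = bidualEval R M m ∘ₗ rightTranspose f := rfl

theorem exists_factor_of_surjective {g : N →ₗ[R] L} (hg : Function.Surjective g)
    {Y : Type u} [AddCommGroup Y] [Module R Y] (φ : N →ₗ[R] Y) (h : ∀ x, g x = 0 → φ x = 0) :
    ∃ ψ : L →ₗ[R] Y, ψ ∘ₗ g = φ := by
  refine ⟨(LinearMap.ker g).liftQ φ h ∘ₗ (g.quotKerEquivOfSurjective hg).symm.toLinearMap, ?_⟩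
  ext x
  have : (g.quotKerEquivOfSurjective hg).symm (g x) = Submodule.Quotient.mk x := by
    rw [LinearEquiv.symm_apply_eq]
    rfl
  simp only [LinearMap.comp_apply, LinearEquiv.coe_coe, this]
  exact (LinearMap.ker g).liftQ_apply φ x

/-- The dual of a short exact sequence `0 → M → N → L → 0` with `Ext¹(L, R) = 0` is short exact. -/
theorem IsShortExact.rightTranspose {f : M →ₗ[R] N} {g : N →ₗ[R] L} (h : IsShortExact f g)
    (hL : Subsingleton (Abelian.Ext.{u} (ModuleCat.of R L) (ModuleCat.of R R) 1)) :
    IsShortExact (rightTranspose g) (rightTranspose f) where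
  injective φ ψ hφ := by
    ext x
    obtain ⟨y, rfl⟩ := h.surjective x
    exact LinearMap.congr_fun hφ y
  exact φ := by
    constructor
    · intro hφ
      obtain ⟨ψ, hψ⟩ := exists_factor_of_surjective h.surjective φ fun x hx => by
        obtain ⟨y, rfl⟩ := (h.exact x).1 hx
        exact LinearMap.congr_fun hφ y
      exact ⟨ψ, hψ⟩
    · rintro ⟨ψ, rfl⟩
      ext x
      simp [h.exact.apply_apply_eq_zero x]
  surjective φ := IsShortExact.exists_extension (A := ModuleCat.of R M) (B := ModuleCat.of R N)
    (C := ModuleCat.of R L) (Y := ModuleCat.of R R) h hL φ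

/-- Retracts of a reflexive module are reflexive. -/
theorem bidualEval_bijective_of_retract (s : M →ₗ[R] N) (r : N →ₗ[R] M)
    (hrs : r ∘ₗ s = LinearMap.id) (h : Function.Bijective (bidualEval R N)) :
    Function.Bijective (bidualEval R M) := by
  have hrs' (x : M) : r (s x) = x := LinearMap.congr_fun hrs x
  constructor
  · intro x y hxy
    rw [← hrs' x, ← hrs' y]
    refine congrArg r (h.1 ?_)
    rw [bidualEval_map, bidualEval_map, hxy]
  · intro φ
    obtain ⟨y, hy⟩ := h.2 (φ ∘ₗ rightTranspose s)
    refine ⟨r y, ?_⟩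
    ext f
    have := LinearMap.congr_fun hy (f ∘ₗ r)
    simp only [bidualEval_apply, LinearMap.comp_apply, rightTranspose_apply] at this ⊢
    rw [this, LinearMap.comp_assoc, hrs, LinearMap.comp_id]

theorem bidualEval_bijective_pi (n : ℕ) : Function.Bijective (bidualEval R (Fin n → R)) := by
  have expand (f : (Fin n → R) →ₗ[R] R) (x : Fin n → R) :
      f x = ∑ i, x i * f (Pi.single i 1) := by
    conv_lhs => rw [← Finset.univ_sum_single x]
    rw [map_sum]
    refine Finset.sum_congr rfl fun i _ => ?_
    rw [← smul_eq_mul, ← map_smul, ← Pi.single_smul, smul_eq_mul, mul_one]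
  constructor
  · intro x y hxy
    ext i
    exact LinearMap.congr_fun hxy (LinearMap.proj i)
  · intro φ
    refine ⟨fun i => φ (LinearMap.proj i), ?_⟩
    ext f
    rw [bidualEval_apply, expand]
    have : f = ∑ i, MulOpposite.op (f (Pi.single i 1)) •
        (LinearMap.proj i : (Fin n → R) →ₗ[R] R) := by
      refine LinearMap.ext fun x => ?_
      rw [LinearMap.sum_apply, expand f]
      rfl
    conv_rhs => rw [this]
    simp [map_sum]

theorem projective_dual_pi (n : ℕ) : Module.Projective Rᵐᵒᵖ ((Fin n → R) →ₗ[R] R) := by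
  let e : Rᵐᵒᵖ ≃ₗ[Rᵐᵒᵖ] R :=
    { MulOpposite.opAddEquiv.symm with
      map_smul' := fun _ _ => rfl }
  have : Module.Free Rᵐᵒᵖ R := .of_equiv e
  exact .of_equiv' (LinearEquiv.piRing R R (Fin n) Rᵐᵒᵖ).symm

/-- A finitely generated projective module is a direct summand of some `Rⁿ`. -/
theorem exists_retract_pi (P : Type u) [AddCommGroup P] [Module R P] [Module.Finite R P]
    [Module.Projective R P] :
    ∃ (n : ℕ) (s : P →ₗ[R] (Fin n → R)) (r : (Fin n → R) →ₗ[R] P), r ∘ₗ s = LinearMap.id := by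
  obtain ⟨n, r, hr⟩ := Module.Finite.exists_fin' R P
  obtain ⟨s, hs⟩ := Module.projective_lifting_property r LinearMap.id hr
  exact ⟨n, s, r, hs⟩

theorem bidualEval_bijective_of_projective (P : Type u) [AddCommGroup P] [Module R P]
    [Module.Finite R P] [Module.Projective R P] : Function.Bijective (bidualEval R P) := by
  obtain ⟨n, s, r, hrs⟩ := exists_retract_pi (R := R) P
  exact bidualEval_bijective_of_retract s r hrs (bidualEval_bijective_pi n)

theorem projective_dual (P : Type u) [AddCommGroup P] [Module R P]
    [Module.Finite R P] [Module.Projective R P] : Module.Projective Rᵐᵒᵖ (P →ₗ[R] R) := by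
  obtain ⟨n, s, r, hrs⟩ := exists_retract_pi (R := R) P
  have := projective_dual_pi (R := R) n
  refine .of_split (rightTranspose r) (rightTranspose s) ?_
  ext φ x
  exact congrArg φ (LinearMap.congr_fun hrs x)

end Dual

/-- Finitely generated projective modules are totally reflexive. -/
theorem IsTotallyReflexive.of_projective (P : ModuleCat.{u} R) [Module.Finite R P]
    [Module.Projective R P] : IsTotallyReflexive R P where
  finite := inferInstance
  reflexive := bidualEval_bijective_of_projective P
  ext_eq_zero _ hi := ext_subsingleton_of_projective (P := P) ‹_› hi
  ext_dual_eq_zero _ hi :=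
    ext_subsingleton_of_projective (P := ModuleCat.of Rᵐᵒᵖ (P →ₗ[R] R)) (projective_dual P) hi

/-- If the syzygy `N` of `M` is totally reflexive and `Ext^i(M, R) = 0` for all `i > 0`, then `M` is
totally reflexive. -/
theorem IsTotallyReflexive.of_syzygy {N P M : ModuleCat.{u} R} {f : N →ₗ[R] P} {g : P →ₗ[R] M}
    [Module.Finite R P] [Module.Projective R P] (h : IsShortExact f g)
    (hN : IsTotallyReflexive R N)
    (hM : ∀ i : ℕ, 0 < i → Subsingleton (Abelian.Ext.{u} M (ModuleCat.of R R) i)) :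
    IsTotallyReflexive R M := by
  have hP : IsTotallyReflexive R P := .of_projective P
  have hd : IsShortExact (rightTranspose g) (rightTranspose f) :=
    h.rightTranspose (hM 1 one_pos)
  refine ⟨.of_surjective g h.surjective, ⟨?_, ?_⟩, hM, fun i hi => ?_⟩
  · refine (injective_iff_map_eq_zero _).2 fun x hx => ?_
    obtain ⟨p, rfl⟩ := h.surjective x
    -- Evaluation at `p` kills the image of `M*`, hence comes from an element of `N** = N`.
    obtain ⟨ψ, hψ⟩ := exists_factor_of_surjective hd.surjective (bidualEval R P p) fun φ hφ => by
      obtain ⟨χ, rfl⟩ := (hd.exact φ).1 hφ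
      exact LinearMap.congr_fun hx χ
    obtain ⟨y, rfl⟩ := hN.reflexive.2 ψ
    have : f y = p := hP.reflexive.1 (by rw [bidualEval_map, hψ])
    rw [← this, h.exact.apply_apply_eq_zero]
  · intro φ
    obtain ⟨ψ, hψ⟩ := hd.exists_extension (A := ModuleCat.of Rᵐᵒᵖ (M →ₗ[R] R))
      (B := ModuleCat.of Rᵐᵒᵖ (P →ₗ[R] R)) (C := ModuleCat.of Rᵐᵒᵖ (N →ₗ[R] R))
      (Y := ModuleCat.of Rᵐᵒᵖ R) (hN.ext_dual_eq_zero 1 one_pos) φ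
    obtain ⟨p, rfl⟩ := hP.reflexive.2 ψ
    exact ⟨g p, hψ⟩
  · exact hd.ext_left (A := ModuleCat.of Rᵐᵒᵖ (M →ₗ[R] R))
      (B := ModuleCat.of Rᵐᵒᵖ (P →ₗ[R] R)) (C := ModuleCat.of Rᵐᵒᵖ (N →ₗ[R] R))
      (hP.ext_dual_eq_zero i hi) (hN.ext_dual_eq_zero (i + 1) i.succ_pos)

/-- `N` is a syzygy of `M` in the weak sense: there is a short exact sequence `0 → N → P → M → 0`
with `P` finitely generated projective, but not necessarily a projective cover of `M`. -/
def IsWeakSyzygy (M N : ModuleCat.{u} R) : Prop :=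
  ∃ (P : ModuleCat.{u} R) (f : N →ₗ[R] P) (g : P →ₗ[R] M),
    Module.Finite R P ∧ Module.Projective R P ∧ IsShortExact f g

section SyzygySequence

variable {X : ℕ → ModuleCat.{u} R} (hX : ∀ j, IsWeakSyzygy (X j) (X (j + 1)))
  (hExt : ∀ j i : ℕ, 0 < i → Subsingleton (Abelian.Ext.{u} (X j) (ModuleCat.of R R) i))

include hX in
/-- First syzygies embed into projective modules, so they are torsionless. -/
theorem bidualEval_injective_of_syzygy (j : ℕ) :
    Function.Injective (bidualEval R (X (j + 1))) := by
  obtain ⟨P, f, g, _, _, h⟩ := hX j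
  refine (injective_iff_map_eq_zero _).2 fun x hx => h.injective ?_
  refine (bidualEval_bijective_of_projective (R := R) P).1 ?_
  rw [bidualEval_map, hx, map_zero, map_zero]
  rfl

include hX hExt

/-- Second syzygies, with all modules in the sequence left orthogonal to `R`, are reflexive. -/
theorem bidualEval_bijective_of_syzygy (j : ℕ) :
    Function.Bijective (bidualEval R (X (j + 2))) := by
  refine ⟨bidualEval_injective_of_syzygy hX (j + 1), fun φ => ?_⟩
  obtain ⟨P, f, g, _, _, h⟩ := hX (j + 1)
  have hd : IsShortExact (rightTranspose g) (rightTranspose f) :=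
    h.rightTranspose (hExt _ 1 one_pos)
  obtain ⟨p, hp⟩ := (bidualEval_bijective_of_projective P).2 (φ ∘ₗ rightTranspose f)
  have hgp : g p = 0 := by
    refine bidualEval_injective_of_syzygy hX j ?_
    rw [bidualEval_map, hp, map_zero, LinearMap.comp_assoc, hd.exact.linearMap_comp_eq_zero,
      LinearMap.comp_zero]
  obtain ⟨y, rfl⟩ := (h.exact p).1 hgp
  refine ⟨y, ?_⟩
  ext ψ
  obtain ⟨χ, rfl⟩ := hd.surjective ψ
  exact LinearMap.congr_fun hp χ

/-- The duals of high syzygies satisfy `Ext^i(-, R) = 0`. For `i = 1` the reason is that every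
functional on the dual of a reflexive module is an evaluation, which extends; the case of general
`i` follows by dimension shifting along the dual sequences. -/
theorem ext_dual_of_syzygy (i j : ℕ) (hij : i + 2 ≤ j) (hi : 0 < i) :
    Subsingleton (Abelian.Ext.{u} (ModuleCat.of Rᵐᵒᵖ (X j →ₗ[R] R)) (ModuleCat.of Rᵐᵒᵖ R) i) := by
  induction i generalizing j with
  | zero => exact absurd hi (lt_irrefl 0)
  | succ i ih =>
    obtain ⟨j, rfl⟩ : ∃ l, j = l + 1 := ⟨j - 1, by omega⟩
    obtain ⟨P, f, g, _, _, h⟩ := hX j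
    have hP : IsTotallyReflexive R P := .of_projective P
    have hd : IsShortExact (rightTranspose g) (rightTranspose f) :=
      h.rightTranspose (hExt _ 1 one_pos)
    rcases i.eq_zero_or_pos with rfl | hi'
    · refine hd.ext_one_of_extension (A := ModuleCat.of Rᵐᵒᵖ (X j →ₗ[R] R))
        (B := ModuleCat.of Rᵐᵒᵖ (P →ₗ[R] R)) (C := ModuleCat.of Rᵐᵒᵖ (X (j + 1) →ₗ[R] R))
        (hP.ext_dual_eq_zero 1 one_pos) fun φ => ?_
      obtain ⟨l, rfl⟩ : ∃ l, j = l + 2 := ⟨j - 2, by omega⟩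
      obtain ⟨x, rfl⟩ := (bidualEval_bijective_of_syzygy hX hExt l).2 φ
      obtain ⟨p, rfl⟩ := h.surjective x
      exact ⟨bidualEval R P p, rfl⟩
    · exact hd.ext_right (A := ModuleCat.of Rᵐᵒᵖ (X j →ₗ[R] R))
        (B := ModuleCat.of Rᵐᵒᵖ (P →ₗ[R] R)) (C := ModuleCat.of Rᵐᵒᵖ (X (j + 1) →ₗ[R] R))
        (hP.ext_dual_eq_zero _ i.succ_pos) (ih j (by omega) hi')

/-- A module `X 0` which recurs as an arbitrarily high syzygy of itself, with all syzygies in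
between left orthogonal to `R`, is totally reflexive: high syzygies satisfy each of the conditions
defining total reflexivity. -/
theorem IsTotallyReflexive.of_recurrent [Module.Finite R (X 0)]
    (hrec : ∀ j, ∃ l, j ≤ l ∧ Nonempty (X l ≃ₗ[R] X 0)) : IsTotallyReflexive R (X 0) := by
  refine ⟨inferInstance, ?_, hExt 0, fun i hi => ?_⟩
  · obtain ⟨l, hl, ⟨e⟩⟩ := hrec 2
    obtain ⟨l, rfl⟩ : ∃ t, l = t + 2 := ⟨l - 2, by omega⟩
    exact bidualEval_bijective_of_retract e.symm.toLinearMap e.toLinearMap (by ext; simp)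
      (bidualEval_bijective_of_syzygy hX hExt l)
  · obtain ⟨l, hl, ⟨e⟩⟩ := hrec (i + 2)
    refine ext_subsingleton_of_retract (X' := ModuleCat.of Rᵐᵒᵖ (X l →ₗ[R] R))
      (rightTranspose e.toLinearMap) (rightTranspose e.symm.toLinearMap) ?_
      (ext_dual_of_syzygy hX hExt i l hl hi)
    ext φ x
    exact congrArg φ (e.apply_symm_apply x)

end SyzygySequence

end TotallyReflexive

/-! ### Sequences of syzygies -/

section SyzygySequences

open CategoryTheory

variable {R : Type u} [Ring R]

theorem IsShortExact.of_equiv {A B C A' C' : Type u} [AddCommGroup A] [Module R A] [AddCommGroup B]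
    [Module R B] [AddCommGroup C] [Module R C] [AddCommGroup A'] [Module R A'] [AddCommGroup C']
    [Module R C'] {f : A →ₗ[R] B} {g : B →ₗ[R] C} (h : IsShortExact f g) (eA : A' ≃ₗ[R] A)
    (eC : C ≃ₗ[R] C') : IsShortExact (f ∘ₗ eA.toLinearMap) (eC.toLinearMap ∘ₗ g) where
  injective := h.injective.comp eA.injective
  exact x := by
    simp only [LinearMap.comp_apply, LinearEquiv.coe_coe, Set.mem_range,
      LinearEquiv.map_eq_zero_iff, h.exact x]
    constructor
    · rintro ⟨y, rfl⟩
      exact ⟨eA.symm y, by simp⟩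
    · rintro ⟨y, rfl⟩
      exact ⟨eA y, rfl⟩
  surjective := eC.surjective.comp h.surjective

theorem IsWeakSyzygy.congr {M N M' N' : ModuleCat.{u} R} (h : IsWeakSyzygy M N)
    (eM : M ≃ₗ[R] M') (eN : N' ≃ₗ[R] N) : IsWeakSyzygy M' N' := by
  obtain ⟨P, f, g, hfin, hproj, hs⟩ := h
  exact ⟨P, _, _, hfin, hproj, hs.of_equiv eN eM⟩

theorem IsWeakSyzygy.finite [IsNoetherianRing R] {M N : ModuleCat.{u} R} (h : IsWeakSyzygy M N) :
    Module.Finite R N := by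
  obtain ⟨P, f, g, _, _, hs⟩ := h
  exact Module.Finite.of_injective f hs.injective

/-- A projective cover of a finitely generated module is finitely generated. -/
theorem IsProjectiveCover.finite {P M : Type u} [AddCommGroup P] [Module R P]
    [AddCommGroup M] [Module R M] [Module.Finite R M] {f : P →ₗ[R] M}
    (h : IsProjectiveCover R f) : Module.Finite R P := by
  obtain ⟨n, r, hr⟩ := Module.Finite.exists_fin' R M
  obtain ⟨s, hs⟩ := Module.projective_lifting_property f r h.surjective
  refine .of_surjective s (LinearMap.range_eq_top.1 (h.superfluous_ker _ ?_))
  refine eq_top_iff.2 fun x _ => ?_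
  obtain ⟨y, hy⟩ := hr (f x)
  refine Submodule.mem_sup.2 ⟨s y, ⟨y, rfl⟩, x - s y, ?_, add_sub_cancel _ _⟩
  rw [LinearMap.mem_ker, map_sub, ← LinearMap.comp_apply, hs, hy, sub_self]

theorem IsSyzygy.isWeakSyzygy {M N : Type u} [AddCommGroup M] [Module R M] [AddCommGroup N]
    [Module R N] [Module.Finite R M] (h : IsSyzygy R M N) :
    IsWeakSyzygy (ModuleCat.of R M) (ModuleCat.of R N) := by
  obtain ⟨P, _, _, g, hg, ⟨e⟩⟩ := h
  have hs : IsShortExact (LinearMap.ker g).subtype g :=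
    ⟨Subtype.val_injective, LinearMap.exact_subtype_ker_map g, hg.surjective⟩
  exact ⟨ModuleCat.of R P, _, _, hg.finite, hg.projective, hs.of_equiv e (LinearEquiv.refl R M)⟩

/-- The iterated syzygies of a finitely generated module, unfolded into a chain of finitely
generated syzygies. Only the terms `L 0, …, L n` matter. -/
theorem IsNthSyzygy.exists_chain [IsNoetherianRing R] {n : ℕ} {M N : Type u} [AddCommGroup M]
    [Module R M] [AddCommGroup N] [Module R N] [hM : Module.Finite R M]
    (h : IsNthSyzygy R n M N) :
    Module.Finite R N ∧ ∃ L : ℕ → ModuleCat.{u} R, Nonempty (L 0 ≃ₗ[R] M) ∧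
      Nonempty (L n ≃ₗ[R] N) ∧ ∀ j < n, IsWeakSyzygy (L j) (L (j + 1)) := by
  induction n generalizing N with
  | zero =>
    obtain ⟨e⟩ := h
    exact ⟨.equiv e.symm, fun _ => ModuleCat.of R M, ⟨LinearEquiv.refl R M⟩, ⟨e.symm⟩,
      fun j hj => absurd hj j.not_lt_zero⟩
  | succ n ih =>
    obtain ⟨K, _, _, hK, hKN⟩ := h
    obtain ⟨hfin, L, ⟨e₀⟩, ⟨eₙ⟩, hL⟩ := ih hK
    have hw := hKN.isWeakSyzygy
    obtain ⟨F, hF, hFn⟩ : ∃ F : ℕ → ModuleCat.{u} R, (∀ j ≤ n, F j = L j) ∧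
        F (n + 1) = ModuleCat.of R N :=
      ⟨fun j => if j ≤ n then L j else ModuleCat.of R N, fun j hj => if_pos hj,
        if_neg (Nat.not_succ_le_self n)⟩
    refine ⟨hw.finite, F, ⟨?_⟩, ⟨?_⟩, ?_⟩
    · rw [hF 0 n.zero_le]
      exact e₀
    · rw [hFn]
    · intro j hj
      rcases Nat.lt_succ_iff_lt_or_eq.1 hj with hj' | rfl
      · rw [hF j hj'.le, hF _ (Nat.succ_le_of_lt hj')]
        exact hL j hj'
      · rw [hF j le_rfl, hFn]
        exact hw.congr eₙ.symm (LinearEquiv.refl R N)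

/-- An eventually periodic finitely generated module over a Noetherian ring has an infinite
sequence of syzygies which is periodic from some point on. -/
theorem IsEventuallyPeriodicModule.exists_syzygySequence [IsNoetherianRing R] {M : Type u}
    [AddCommGroup M] [Module R M] [Module.Finite R M] (h : IsEventuallyPeriodicModule R M) :
    ∃ (X : ℕ → ModuleCat.{u} R) (n p : ℕ), 0 < p ∧ Nonempty (X 0 ≃ₗ[R] M) ∧
      (∀ j, IsWeakSyzygy (X j) (X (j + 1))) ∧ ∀ j, n ≤ j → Nonempty (X (j + p) ≃ₗ[R] X j) := by
  obtain ⟨n, N, _, _, hN, p, hp, hper⟩ := h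
  obtain ⟨hfin, A, ⟨eA₀⟩, ⟨eAₙ⟩, hA⟩ := hN.exists_chain
  obtain ⟨-, L, ⟨eL₀⟩, ⟨eLₚ⟩, hL⟩ := hper.exists_chain
  obtain ⟨F, hF, hF'⟩ : ∃ F : ℕ → ModuleCat.{u} R, (∀ j < n, F j = A j) ∧
      ∀ j ≥ n, F j = L ((j - n) % p) :=
    ⟨fun j => if j < n then A j else L ((j - n) % p), fun j hj => if_pos hj,
      fun j hj => if_neg hj.not_gt⟩
  refine ⟨F, n, p, hp, ⟨?_⟩, fun j => ?_, fun j hj => ⟨?_⟩⟩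
  · by_cases hn : 0 < n
    · rw [hF 0 hn]
      exact eA₀
    · obtain rfl : n = 0 := by omega
      rw [hF' 0 le_rfl, Nat.sub_zero, Nat.zero_mod]
      exact eL₀.trans (eAₙ.symm.trans eA₀)
  · rcases lt_trichotomy (j + 1) n with hj | hj | hj
    · rw [hF j (by omega), hF _ hj]
      exact hA j (by omega)
    · rw [hF j (by omega), hF' (j + 1) hj.ge, hj, Nat.sub_self, Nat.zero_mod]
      have := hA j (by omega)
      rw [hj] at this
      exact this.congr (LinearEquiv.refl R _) (eL₀.trans eAₙ.symm)
    · rw [hF' j (by omega), hF' (j + 1) (by omega)]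
      have hlt : (j - n) % p < p := Nat.mod_lt _ hp
      have hstep : (j + 1 - n) % p = ((j - n) % p + 1) % p := by
        rw [Nat.mod_add_mod, show j + 1 - n = j - n + 1 by omega]
      rw [hstep]
      rcases Nat.lt_or_ge ((j - n) % p + 1) p with h' | h'
      · rw [Nat.mod_eq_of_lt h']
        exact hL _ hlt
      · have h'' : (j - n) % p + 1 = p := by omega
        have := hL _ hlt
        rw [h''] at this
        rw [h'', Nat.mod_self]
        exact this.congr (LinearEquiv.refl R _) (eL₀.trans eLₚ.symm)
  · rw [hF' (j + p) (by omega), hF' j hj, show j + p - n = j - n + p by omega, Nat.add_mod_right]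

section Sequence

variable {X : ℕ → ModuleCat.{u} R} (hX : ∀ j, IsWeakSyzygy (X j) (X (j + 1)))

include hX

/-- Dimension shifting along a sequence of syzygies. -/
theorem ext_subsingleton_syzygy_iff {Y : ModuleCat.{u} R} (j i : ℕ) (hi : 0 < i) :
    Subsingleton (Abelian.Ext.{u} (X j) Y i) ↔ Subsingleton (Abelian.Ext.{u} (X 0) Y (j + i)) := by
  induction j generalizing i with
  | zero => rw [zero_add]
  | succ j ih =>
    obtain ⟨P, f, g, _, hP, hs⟩ := hX j
    rw [show j + 1 + i = j + (i + 1) by ring, ← ih (i + 1) i.succ_pos]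
    exact ⟨fun h => hs.ext_right (ext_subsingleton_of_projective hP i.succ_pos) h,
      fun h => hs.ext_left (ext_subsingleton_of_projective hP hi) h⟩

theorem syzygySequence_finite [IsNoetherianRing R] (h₀ : Module.Finite R (X 0)) (j : ℕ) :
    Module.Finite R (X j) := by
  cases j with
  | zero => exact h₀
  | succ j => exact (hX j).finite

omit hX in
theorem exists_periodic_iso {n p : ℕ}
    (hper : ∀ j, n ≤ j → Nonempty (X (j + p) ≃ₗ[R] X j)) {j : ℕ} (hj : n ≤ j) (m : ℕ) :
    Nonempty (X (j + m * p) ≃ₗ[R] X j) := by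
  induction m with
  | zero => exact ⟨by rw [zero_mul]; exact LinearEquiv.refl R _⟩
  | succ m ih =>
    obtain ⟨e⟩ := ih
    obtain ⟨e'⟩ := hper (j + m * p) (by omega)
    rw [add_mul, one_mul, ← add_assoc]
    exact ⟨e'.trans e⟩

/-- In an eventually periodic sequence of syzygies, `X d` is totally reflexive as soon as
`Ext^i(X 0, R) = 0` for all `i > d`. -/
theorem isTotallyReflexive_syzygy [IsNoetherianRing R] (h₀ : Module.Finite R (X 0)) {n p : ℕ}
    (hp : 0 < p) (hper : ∀ j, n ≤ j → Nonempty (X (j + p) ≃ₗ[R] X j)) (d : ℕ)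
    (hext : ∀ i, d < i → Subsingleton (Abelian.Ext.{u} (X 0) (ModuleCat.of R R) i)) :
    IsTotallyReflexive R (X d) := by
  have hext' (j i : ℕ) (hj : d ≤ j) (hi : 0 < i) :
      Subsingleton (Abelian.Ext.{u} (X j) (ModuleCat.of R R) i) :=
    (ext_subsingleton_syzygy_iff hX j i hi).2 (hext _ (by omega))
  -- Total reflexivity holds in the periodic range and descends along the syzygies to `d`.
  have key (t : ℕ) : d + t ≥ n → IsTotallyReflexive R (X (d + t)) := fun ht => by
    have := syzygySequence_finite hX h₀ (d + t)
    refine IsTotallyReflexive.of_recurrent (X := fun j => X (d + t + j)) (fun j => hX _)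
      (fun j i hi => hext' _ _ (by omega) hi) fun j => ⟨j * p, Nat.le_mul_of_pos_right j hp, ?_⟩
    exact exists_periodic_iso hper ht j
  have down (t : ℕ) (h : IsTotallyReflexive R (X (d + t))) : IsTotallyReflexive R (X d) := by
    induction t with
    | zero => exact h
    | succ t ih =>
      obtain ⟨P, f, g, _, _, hs⟩ := hX (d + t)
      exact ih (.of_syzygy hs h fun i hi => hext' _ i (by omega) hi)
  exact down n (key n (by omega))

end Sequence

section ChangeOfRings

variable {S : Type u} [Ring S] (e : S ≃+* R)

/-- A module over `R` viewed over an isomorphic ring `S`. -/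
noncomputable abbrev restrictRing (M : ModuleCat.{u} R) : ModuleCat.{u} S :=
  (ModuleCat.restrictScalars (e : S →+* R)).obj M

variable {e}

theorem restrictRing_smul {M : ModuleCat.{u} R} (s : S) (m : restrictRing e M) :
    s • m = (e s • (show M from m) : M) := rfl

/-- Restriction of scalars of a linear map along a ring isomorphism. -/
noncomputable def restrictRingMap {M N : ModuleCat.{u} R} (f : M →ₗ[R] N) :
    restrictRing e M →ₗ[S] restrictRing e N where
  toFun := f
  map_add' := f.map_add
  map_smul' s m := f.map_smul (e s) m

/-- Restriction of scalars of a linear equivalence along a ring isomorphism. -/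
noncomputable def restrictRingEquiv {M N : ModuleCat.{u} R} (f : M ≃ₗ[R] N) :
    restrictRing e M ≃ₗ[S] restrictRing e N :=
  { f.toAddEquiv with map_smul' := fun s m => f.map_smul (e s) m }

theorem IsShortExact.restrictScalars {A B C : ModuleCat.{u} R} {f : A →ₗ[R] B} {g : B →ₗ[R] C}
    (h : IsShortExact f g) :
    IsShortExact (restrictRingMap (e := e) f) (restrictRingMap (e := e) g) :=
  ⟨h.injective, h.exact, h.surjective⟩

attribute [local instance] RingHomInvPair.of_ringEquiv in
theorem restrictRing_projective {P : ModuleCat.{u} R} (h : Module.Projective R P) :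
    Module.Projective S (restrictRing e P) := by
  let i : P ≃ₛₗ[(e.symm : R →+* S)] restrictRing e P :=
    { AddEquiv.refl P with
      map_smul' := fun r m => by
        change r • m = e (e.symm r) • m
        rw [e.apply_symm_apply] }
  exact .of_equiv i

theorem restrictRing_finite {P : ModuleCat.{u} R} (h : Module.Finite R P) :
    Module.Finite S (restrictRing e P) := by
  obtain ⟨n, s, hs⟩ := Module.Finite.exists_fin' R P
  refine .of_surjective
    ({ toFun := fun x => s fun i => e (x i)
       map_add' := fun x y => ?_
       map_smul' := fun r x => ?_ } : (Fin n → S) →ₗ[S] restrictRing e P) fun x => ?_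
  · exact (congrArg s (funext fun i => map_add e _ _)).trans (s.map_add _ _)
  · exact (congrArg s (funext fun i => map_mul e _ _)).trans (s.map_smul (e r) fun i => e (x i))
  · obtain ⟨y, hy⟩ := hs x
    refine ⟨fun i => e.symm (y i), ?_⟩
    exact (congrArg s (funext fun i => e.apply_symm_apply (y i))).trans hy

theorem IsWeakSyzygy.restrictScalars {M N : ModuleCat.{u} R} (h : IsWeakSyzygy M N) :
    IsWeakSyzygy (restrictRing e M) (restrictRing e N) := by
  obtain ⟨P, f, g, hfin, hproj, hs⟩ := h
  exact ⟨restrictRing e P, _, _, restrictRing_finite hfin, restrictRing_projective hproj,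
    hs.restrictScalars⟩

/-- The vanishing of `Ext¹(M, R)` is transported along a ring isomorphism, via the extension
problem it is equivalent to. -/
theorem IsWeakSyzygy.ext_one_restrictRing {M N : ModuleCat.{u} R} (h : IsWeakSyzygy M N)
    (hM : Subsingleton (Abelian.Ext.{u} M (ModuleCat.of R R) 1)) :
    Subsingleton (Abelian.Ext.{u} (restrictRing e M) (ModuleCat.of S S) 1) := by
  obtain ⟨P, f, g, hfin, hproj, hs⟩ := h
  refine (hs.restrictScalars (e := e)).ext_one_of_extension
    (ext_subsingleton_of_projective (restrictRing_projective hproj) one_pos) fun φ => ?_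
  let φ' : N →ₗ[R] R :=
    { toFun := fun x => e (φ x)
      map_add' := fun x y => (congrArg e (φ.map_add x y)).trans (map_add e _ _)
      map_smul' := fun r x => by
        have hr : (r • x : N) = (e.symm r • (show restrictRing e N from x) : restrictRing e N) := by
          rw [restrictRing_smul, e.apply_symm_apply]
        refine (congrArg e ((congrArg φ hr).trans (φ.map_smul (e.symm r) x))).trans ?_
        exact (map_mul e _ _).trans (congrArg (· * _) (e.apply_symm_apply r)) }
  obtain ⟨ψ, hψ⟩ := hs.exists_extension hM φ'
  refine ⟨{ toFun := fun x => e.symm (ψ x)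
            map_add' := fun x y => ?_
            map_smul' := fun s x => ?_ }, ?_⟩
  · exact (congrArg e.symm (ψ.map_add x y)).trans (map_add e.symm _ _)
  · exact (congrArg e.symm (ψ.map_smul (e s) x)).trans
      ((map_mul e.symm _ _).trans (congrArg (· * _) (e.symm_apply_apply s)))
  · ext x
    exact (congrArg e.symm (LinearMap.congr_fun hψ x)).trans (e.symm_apply_apply _)

end ChangeOfRings

end SyzygySequences

/-! ### The left dual of a bimodule -/

section LeftDual

open MulOpposite

variable (k : Type v) [Field k] (Λ : Type u) [Ring Λ] [Algebra k Λ]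

/-- The left dual `Hom_Λ(K, Λ)` of a bimodule `K`: the additive maps `K → Λ` which are linear for
the left action of `Λ` on `K`. -/
def leftDual (K : Type u) [AddCommGroup K] [Module (EnvelopingAlgebra k Λ) K] :
    AddSubgroup (K →+ Λ) where
  carrier := {f | ∀ a x, f ((a ⊗ₜ[k] 1 : EnvelopingAlgebra k Λ) • x) = a * f x}
  zero_mem' a x := by simp
  add_mem' hf hg a x := by simp [hf a x, hg a x, mul_add]
  neg_mem' hf a x := by simp [hf a x]

variable {k Λ}

section Module

variable {K : Type u} [AddCommGroup K] [Module (EnvelopingAlgebra k Λ) K]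

theorem leftDual_map_smul (f : leftDual k Λ K) (a : Λ) (x : K) :
    f.1 ((a ⊗ₜ[k] 1 : EnvelopingAlgebra k Λ) • x) = a * f.1 x := f.2 a x

theorem leftDual_ext {f g : leftDual k Λ K} (h : ∀ x, f.1 x = g.1 x) : f = g :=
  Subtype.ext (AddMonoidHom.ext h)

/-- The left action on `Hom_Λ(K, Λ)` induced by the right action of `Λ` on `K`. -/
instance leftDual.instModule : Module Λ (leftDual k Λ K) where
  smul b f := ⟨f.1.comp (DistribSMul.toAddMonoidHom K (1 ⊗ₜ[k] op b : EnvelopingAlgebra k Λ)),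
    fun a x => by
      simp only [AddMonoidHom.comp_apply, DistribSMul.toAddMonoidHom_apply]
      rw [← leftDual_map_smul, smul_smul, smul_smul]
      simp⟩
  one_smul f := leftDual_ext fun x => congrArg f.1 (one_smul (EnvelopingAlgebra k Λ) x)
  mul_smul a b f := leftDual_ext fun x => congrArg f.1 <| by
    change _ = (1 ⊗ₜ[k] op b : EnvelopingAlgebra k Λ) • (1 ⊗ₜ[k] op a : EnvelopingAlgebra k Λ) • x
    rw [smul_smul]
    simp
  smul_zero a := rfl
  smul_add a f g := rfl
  add_smul a b f := leftDual_ext fun x => by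
    change f.1 ((1 ⊗ₜ[k] op (a + b) : EnvelopingAlgebra k Λ) • x) = f.1 _ + f.1 _
    rw [op_add, TensorProduct.tmul_add, add_smul, map_add]
    rfl
  zero_smul f := leftDual_ext fun x => by
    change f.1 ((1 ⊗ₜ[k] op 0 : EnvelopingAlgebra k Λ) • x) = 0
    rw [op_zero, TensorProduct.tmul_zero]
    exact (congrArg f.1 (zero_smul (EnvelopingAlgebra k Λ) x)).trans (map_zero _)

theorem leftDual_smul_apply (b : Λ) (f : leftDual k Λ K) (x : K) :
    (b • f).1 x = f.1 ((1 ⊗ₜ[k] op b : EnvelopingAlgebra k Λ) • x) := rfl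

theorem leftDual_map_tmul (f : leftDual k Λ K) (a b : Λ) (x : K) :
    f.1 ((a ⊗ₜ[k] op b : EnvelopingAlgebra k Λ) • x) = a * (b • f).1 x := by
  rw [leftDual_smul_apply, ← leftDual_map_smul, smul_smul]
  simp

theorem algebraMap_tmul_one (c : k) :
    (algebraMap k Λ c ⊗ₜ[k] 1 : EnvelopingAlgebra k Λ) = 1 ⊗ₜ[k] op (algebraMap k Λ c) := by
  rw [Algebra.algebraMap_eq_smul_one, TensorProduct.smul_tmul, op_smul, op_one]

theorem leftDual_algebraMap_smul (c : k) (f : leftDual k Λ K) (x : K) :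
    (algebraMap k Λ c • f).1 x = c • f.1 x := by
  rw [leftDual_smul_apply, ← algebraMap_tmul_one, leftDual_map_smul, Algebra.smul_def]

variable {K' : Type u} [AddCommGroup K'] [Module (EnvelopingAlgebra k Λ) K']

/-- The transpose of a bimodule map. -/
def leftDualMap (f : K →ₗ[EnvelopingAlgebra k Λ] K') : leftDual k Λ K' →ₗ[Λ] leftDual k Λ K where
  toFun φ := ⟨φ.1.comp f.toAddMonoidHom, fun a x => by
    simp [leftDual_map_smul]⟩
  map_add' _ _ := rfl
  map_smul' b φ := leftDual_ext fun x => congrArg φ.1 (f.map_smul _ x).symm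

@[simp]
theorem leftDualMap_apply (f : K →ₗ[EnvelopingAlgebra k Λ] K') (φ : leftDual k Λ K') (x : K) :
    (leftDualMap f φ).1 x = φ.1 (f x) := rfl

/-- Isomorphic bimodules have isomorphic left duals. -/
def leftDualEquiv (e : K ≃ₗ[EnvelopingAlgebra k Λ] K') :
    leftDual k Λ K' ≃ₗ[Λ] leftDual k Λ K :=
  LinearEquiv.ofLinearMap (leftDualMap e.toLinearMap) (leftDualMap e.symm.toLinearMap)
    (LinearMap.ext fun φ => leftDual_ext fun x => congrArg φ.1 (e.symm_apply_apply x))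
    (LinearMap.ext fun φ => leftDual_ext fun x => congrArg φ.1 (e.apply_symm_apply x))

end Module

/-- A map that is additive and respects pure tensors is linear over the enveloping algebra. -/
def envelopingLinearMap {K L : Type u} [AddCommGroup K] [Module (EnvelopingAlgebra k Λ) K]
    [AddCommGroup L] [Module (EnvelopingAlgebra k Λ) L] (f : K →+ L)
    (hf : ∀ a b x, f ((a ⊗ₜ[k] op b : EnvelopingAlgebra k Λ) • x) =
      (a ⊗ₜ[k] op b : EnvelopingAlgebra k Λ) • f x) : K →ₗ[EnvelopingAlgebra k Λ] L :=
  { f with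
    map_smul' := fun r x => by
      change f (r • x) = r • f x
      induction r using TensorProduct.induction_on with
      | zero =>
        exact (congrArg f (zero_smul (EnvelopingAlgebra k Λ) x)).trans
          ((map_zero f).trans (zero_smul (EnvelopingAlgebra k Λ) (f x)).symm)
      | tmul a b => exact hf a b.unop x
      | add r s hr hs => rw [add_smul, map_add, hr, hs, add_smul] }

theorem regularBimodule_tmul_one_smul (a x : Λ) :
    letI := regularBimodule k Λ
    (a ⊗ₜ[k] 1 : EnvelopingAlgebra k Λ) • x = a * x := by
  rw [← op_one, regularBimodule_smul, mul_one]

theorem regularBimodule_one_tmul_smul (b x : Λ) :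
    letI := regularBimodule k Λ
    (1 ⊗ₜ[k] op b : EnvelopingAlgebra k Λ) • x = x * b := by
  rw [regularBimodule_smul, one_mul]

/-- The left dual of the regular bimodule is the left regular module. -/
def leftDualRegular : letI := regularBimodule k Λ; leftDual k Λ Λ ≃ₗ[Λ] Λ :=
  letI := regularBimodule k Λ
  { toFun := fun f => f.1 1
    map_add' := fun f g => rfl
    map_smul' := fun b f => by
      have h := leftDual_map_smul f b 1
      rw [regularBimodule_tmul_one_smul, mul_one] at h
      rw [leftDual_smul_apply, regularBimodule_one_tmul_smul, one_mul, h]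
      rfl
    invFun := fun b => ⟨AddMonoidHom.mulRight b, fun a x => by
      rw [regularBimodule_tmul_one_smul]
      exact mul_assoc a x b⟩
    left_inv := fun f => leftDual_ext fun x => by
      have h := leftDual_map_smul f x 1
      rw [regularBimodule_tmul_one_smul, mul_one] at h
      exact h.symm
    right_inv := fun b => one_mul b }

/-! ### Coinduced bimodules and injectivity of left duals -/

section Coinduced

variable (k Λ)

/-- The bimodule `Hom_k(M, Λ)` attached to a left `Λ`-module `M`, with left action through `Λ` and
right action through `M`. -/
def scalarHom (M : Type u) [AddCommGroup M] [Module k M] : Type u := M →ₗ[k] Λ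

variable {k Λ} {M N : Type u} [AddCommGroup M] [Module k M] [Module Λ M] [IsScalarTower k Λ M]
  [AddCommGroup N] [Module k N] [Module Λ N] [IsScalarTower k Λ N]

instance : AddCommGroup (scalarHom k Λ M) := inferInstanceAs (AddCommGroup (M →ₗ[k] Λ))

instance : Module k (scalarHom k Λ M) := inferInstanceAs (Module k (M →ₗ[k] Λ))

instance : Module Λ (scalarHom k Λ M) := inferInstanceAs (Module Λ (M →ₗ[k] Λ))

instance : FunLike (scalarHom k Λ M) M Λ := inferInstanceAs (FunLike (M →ₗ[k] Λ) M Λ)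

instance : LinearMapClass (scalarHom k Λ M) k M Λ :=
  inferInstanceAs (LinearMapClass (M →ₗ[k] Λ) k M Λ)

omit [Module Λ M] [IsScalarTower k Λ M] in
theorem scalarHom_ext {h h' : scalarHom k Λ M} (H : ∀ m, h m = h' m) : h = h' :=
  LinearMap.ext H

omit [Module Λ M] [IsScalarTower k Λ M] in
theorem scalarHom_sum_apply {ι : Type*} (s : Finset ι) (h : ι → scalarHom k Λ M) (m : M) :
    (∑ i ∈ s, h i) m = ∑ i ∈ s, h i m :=
  LinearMap.sum_apply s (fun i => (h i : M →ₗ[k] Λ)) m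

instance : Module Λᵐᵒᵖ (scalarHom k Λ M) where
  smul b h := LinearMap.comp (h : M →ₗ[k] Λ) (Algebra.lsmul k k M b.unop)
  one_smul h := LinearMap.ext fun m => congrArg h (one_smul Λ m)
  mul_smul a b h := LinearMap.ext fun m => congrArg h (mul_smul b.unop a.unop m)
  smul_zero _ := rfl
  smul_add _ _ _ := rfl
  add_smul a b h := LinearMap.ext fun m =>
    (congrArg h (add_smul a.unop b.unop m)).trans (map_add h _ _)
  zero_smul h := LinearMap.ext fun m =>
    (congrArg h (zero_smul Λ m)).trans (map_zero h)

instance : SMulCommClass Λ Λᵐᵒᵖ (scalarHom k Λ M) := ⟨fun _ _ _ => rfl⟩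

instance : IsScalarTower k Λ (scalarHom k Λ M) :=
  ⟨fun c a h => LinearMap.ext fun m => smul_mul_assoc c a (h m)⟩

instance : IsScalarTower k Λᵐᵒᵖ (scalarHom k Λ M) :=
  ⟨fun c a h => LinearMap.ext fun m =>
    (congrArg h (smul_assoc c a.unop m)).trans (map_smul h c _)⟩

instance : Module (EnvelopingAlgebra k Λ) (scalarHom k Λ M) := TensorProduct.Algebra.module

theorem scalarHom_smul_apply (a b : Λ) (h : scalarHom k Λ M) (m : M) :
    ((a ⊗ₜ[k] op b : EnvelopingAlgebra k Λ) • h) m = a * h (b • m) := rfl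

variable {K : Type u} [AddCommGroup K] [Module (EnvelopingAlgebra k Λ) K]

/-- The adjunction `Hom_Λ(M, Hom_Λ(K, Λ)) → Hom_{Λᵉ}(K, Hom_k(M, Λ))`. -/
def toScalarHom (g : M →ₗ[Λ] leftDual k Λ K) : K →ₗ[EnvelopingAlgebra k Λ] scalarHom k Λ M :=
  envelopingLinearMap
    (AddMonoidHom.mk' (fun x =>
      ({ toFun := fun m => (g m).1 x
         map_add' := fun m m' => by rw [map_add]; rfl
         map_smul' := fun c m => by
          rw [← algebraMap_smul Λ c m, map_smul, leftDual_algebraMap_smul]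
          rfl } : M →ₗ[k] Λ)) fun x y => LinearMap.ext fun m => map_add (g m).1 x y)
    fun a b x => LinearMap.ext fun m => by
      refine (leftDual_map_tmul (g m) a b x).trans ?_
      rw [← map_smul]
      rfl

/-- The adjunction `Hom_{Λᵉ}(K, Hom_k(M, Λ)) → Hom_Λ(M, Hom_Λ(K, Λ))`. -/
def ofScalarHom (h : K →ₗ[EnvelopingAlgebra k Λ] scalarHom k Λ M) : M →ₗ[Λ] leftDual k Λ K where
  toFun m := ⟨AddMonoidHom.mk' (fun x => h x m) fun x y => by rw [map_add]; rfl, fun a x => by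
    change h _ m = a * h x m
    rw [h.map_smul, ← op_one, scalarHom_smul_apply, one_smul]⟩
  map_add' m m' := leftDual_ext fun x => map_add (h x) m m'
  map_smul' b m := leftDual_ext fun x => by
    change h x (b • m) = h ((1 ⊗ₜ[k] op b : EnvelopingAlgebra k Λ) • x) m
    rw [h.map_smul, scalarHom_smul_apply, one_mul]

/-- Restriction `Hom_k(N, Λ) → Hom_k(M, Λ)` along a map `M → N` of left modules. -/
def scalarHomMap (i : M →ₗ[Λ] N) : scalarHom k Λ N →ₗ[EnvelopingAlgebra k Λ] scalarHom k Λ M :=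
  envelopingLinearMap
    (AddMonoidHom.mk' (fun h => LinearMap.comp (h : N →ₗ[k] Λ) (i.restrictScalars k))
      fun _ _ => rfl)
    fun a b h => LinearMap.ext fun m => by
      change a * h (b • i m) = a * h (i (b • m))
      rw [i.map_smul]

/-- The left dual of a projective bimodule is an injective left module. -/
theorem leftDual_injective (P : Type u) [AddCommGroup P] [Module (EnvelopingAlgebra k Λ) P]
    [Module.Projective (EnvelopingAlgebra k Λ) P] : Module.Injective Λ (leftDual k Λ P) := by
  refine Module.Baer.injective fun I g => ?_
  -- Under the adjunction, extending `g` amounts to lifting along `Hom_k(Λ, Λ) → Hom_k(I, Λ)`.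
  have hsurj : Function.Surjective (scalarHomMap (k := k) (I.subtype)) := fun h => by
    obtain ⟨h', hh'⟩ := LinearMap.exists_extend (p := I.restrictScalars k) (h : I →ₗ[k] Λ)
    exact ⟨h', hh'⟩
  obtain ⟨t, ht⟩ := Module.projective_lifting_property _ (toScalarHom g) hsurj
  refine ⟨ofScalarHom t, fun x hx => leftDual_ext fun y => ?_⟩
  exact congrArg (fun f : scalarHom k Λ I => f ⟨x, hx⟩) (LinearMap.congr_fun ht y)

end Coinduced

end LeftDual

/-! ### The dual of the right regular module -/

section RegularDual

open MulOpposite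

variable (k : Type v) [Field k] (Λ : Type u) [Ring Λ] [Algebra k Λ]

/-- The left module `D(Λ) = Hom_k(Λ, k)`, with `(a • f) x = f (x * a)`. In order to stay in the
universe of `Λ`, the field `k` is replaced by its image `k · 1` in `Λ`; this is the zero module
if `Λ = 0`, but then both versions of `D(Λ)` vanish. -/
def regularDual : Type u := Λ →ₗ[k] (1 : Submodule k Λ)

variable {k Λ}

instance : AddCommGroup (regularDual k Λ) :=
  inferInstanceAs (AddCommGroup (Λ →ₗ[k] (1 : Submodule k Λ)))

instance : Module k (regularDual k Λ) :=
  inferInstanceAs (Module k (Λ →ₗ[k] (1 : Submodule k Λ)))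

instance : FunLike (regularDual k Λ) Λ (1 : Submodule k Λ) :=
  inferInstanceAs (FunLike (Λ →ₗ[k] (1 : Submodule k Λ)) Λ (1 : Submodule k Λ))

instance : LinearMapClass (regularDual k Λ) k Λ (1 : Submodule k Λ) :=
  inferInstanceAs (LinearMapClass (Λ →ₗ[k] (1 : Submodule k Λ)) k Λ (1 : Submodule k Λ))

theorem regularDual_ext {f g : regularDual k Λ} (h : ∀ x, f x = g x) : f = g :=
  LinearMap.ext h

instance : Module Λ (regularDual k Λ) where
  smul a f := LinearMap.comp (f : Λ →ₗ[k] (1 : Submodule k Λ)) (LinearMap.mulRight k a)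
  one_smul f := regularDual_ext fun x => congrArg f (mul_one x)
  mul_smul a b f := regularDual_ext fun x => congrArg f (mul_assoc x a b).symm
  smul_zero _ := rfl
  smul_add _ _ _ := rfl
  add_smul a b f := regularDual_ext fun x =>
    (congrArg f (mul_add x a b)).trans (map_add f _ _)
  zero_smul f := regularDual_ext fun x => (congrArg f (mul_zero x)).trans (map_zero f)

instance : IsScalarTower k Λ (regularDual k Λ) :=
  ⟨fun c a f => regularDual_ext fun x =>
    (congrArg f (mul_smul_comm c x a)).trans (map_smul f c _)⟩

/-- The bimodule map `Λᵉ → Hom_k(D(Λ), Λ)` sending `a ⊗ b` to `f ↦ a * f b`. -/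
def envelopingToScalarHom :
    EnvelopingAlgebra k Λ →ₗ[EnvelopingAlgebra k Λ] scalarHom k Λ (regularDual k Λ) :=
  LinearMap.toSpanSingleton _ _
    ({ toFun := fun f => (f 1 : Λ)
       map_add' := fun _ _ => rfl
       map_smul' := fun _ _ => rfl } : regularDual k Λ →ₗ[k] Λ)

theorem envelopingToScalarHom_tmul (a b : Λ) (f : regularDual k Λ) :
    envelopingToScalarHom (a ⊗ₜ[k] op b) f = a * f b := by
  change a * ((f (1 * b) : (1 : Submodule k Λ)) : Λ) = _
  rw [one_mul]

variable [FiniteDimensional k Λ]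

/-- The coordinate functions of a basis of `Λ`, as elements of `D(Λ)`. -/
noncomputable def regularDualCoord (i : Fin (Module.finrank k Λ)) : regularDual k Λ :=
  LinearMap.toSpanSingleton k (1 : Submodule k Λ) ⟨1, Submodule.mem_one.2 ⟨1, map_one _⟩⟩ ∘ₗ
    (Module.finBasis k Λ).coord i

theorem regularDualCoord_apply (i : Fin (Module.finrank k Λ)) (x : Λ) :
    (regularDualCoord (k := k) i x : Λ) = (Module.finBasis k Λ).repr x i • (1 : Λ) := rfl

theorem sum_regularDualCoord_mul (x : Λ) :
    ∑ i, (regularDualCoord (k := k) i x : Λ) * Module.finBasis k Λ i = x := by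
  simp only [regularDualCoord_apply, smul_mul_assoc, one_mul]
  exact (Module.finBasis k Λ).sum_repr x

theorem envelopingToScalarHom_bijective :
    Function.Bijective (envelopingToScalarHom (k := k) (Λ := Λ)) := by
  -- The inverse is given by the Casimir-type formula `h ↦ ∑ h(eᵢ*) ⊗ eᵢ` for a basis `eᵢ` of `Λ`.
  let inv : scalarHom k Λ (regularDual k Λ) → EnvelopingAlgebra k Λ := fun h =>
    ∑ i, h (regularDualCoord (k := k) i) ⊗ₜ[k] op (Module.finBasis k Λ i)
  have inv_add (h h' : scalarHom k Λ (regularDual k Λ)) : inv (h + h') = inv h + inv h' := by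
    simp only [inv, ← Finset.sum_add_distrib, ← TensorProduct.add_tmul]
    rfl
  refine Function.bijective_iff_has_inverse.2 ⟨inv, fun x => ?_, fun h => ?_⟩
  · induction x using TensorProduct.induction_on with
    | zero =>
      have : inv 0 = 0 := by simpa using inv_add 0 0
      exact (congrArg inv (map_zero (envelopingToScalarHom (k := k) (Λ := Λ)))).trans this
    | tmul a b =>
      have hb := (Module.finBasis k Λ).sum_repr b.unop
      conv_rhs => rw [← op_unop b, ← hb, Finset.op_sum, TensorProduct.tmul_sum]
      refine Finset.sum_congr rfl fun i _ => ?_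
      rw [← op_unop b, envelopingToScalarHom_tmul, regularDualCoord_apply, mul_smul_comm, mul_one,
        op_smul, TensorProduct.smul_tmul]
      rfl
    | add x y hx hy => rw [map_add, inv_add, hx, hy]
  · refine scalarHom_ext fun f => ?_
    choose c hc using fun i => Submodule.mem_one.1 (f (Module.finBasis k Λ i)).2
    have hf : f = ∑ i, c i • regularDualCoord (k := k) i := by
      refine (Module.finBasis k Λ).ext fun j => Subtype.ext ?_
      have hj := congrArg Subtype.val (LinearMap.sum_apply Finset.univ
        (fun i => (c i • regularDualCoord (k := k) i : Λ →ₗ[k] (1 : Submodule k Λ)))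
        (Module.finBasis k Λ j))
      refine Eq.trans ?_ hj.symm
      rw [AddSubmonoidClass.coe_finsetSum]
      change (f (Module.finBasis k Λ j) : Λ) =
        ∑ i, c i • ((Module.finBasis k Λ).repr (Module.finBasis k Λ j) i • (1 : Λ))
      simp [Finsupp.single_apply, ← hc, Algebra.algebraMap_eq_smul_one]
    rw [map_sum, scalarHom_sum_apply]
    conv_rhs => rw [hf, map_sum]
    refine Finset.sum_congr rfl fun i _ => ?_
    rw [envelopingToScalarHom_tmul, ← hc, map_smul, ← Algebra.commutes, Algebra.smul_def]

/-- `Hom_k(D(Λ), Λ)` is the free bimodule of rank one. -/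
noncomputable def envelopingEquivScalarHom :
    EnvelopingAlgebra k Λ ≃ₗ[EnvelopingAlgebra k Λ] scalarHom k Λ (regularDual k Λ) :=
  LinearEquiv.ofBijective _ envelopingToScalarHom_bijective

/-- The left dual of a finitely generated bimodule embeds into a finite power of `D(Λ)`. -/
theorem exists_leftDual_embedding (K : Type u) [AddCommGroup K] [Module (EnvelopingAlgebra k Λ) K]
    [Module.Finite (EnvelopingAlgebra k Λ) K] :
    ∃ (n : ℕ) (s : leftDual k Λ K →ₗ[Λ] (Fin n × Fin (Module.finrank k Λ) → regularDual k Λ)),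
      Function.Injective s := by
  obtain ⟨n, r, hr⟩ := Module.Finite.exists_fin' (EnvelopingAlgebra k Λ) K
  let y : Fin n → K := fun t => r (Pi.single t 1)
  -- The map `c ↦ f (yₜ c)` attached to a left linear map `f` and a generator `yₜ`.
  let ev (t : Fin n) (f : leftDual k Λ K) : Λ →ₗ[k] Λ :=
    { toFun := fun c => f.1 ((1 ⊗ₜ[k] op c : EnvelopingAlgebra k Λ) • y t)
      map_add' := fun c c' => by
        rw [op_add, TensorProduct.tmul_add, add_smul, map_add]
      map_smul' := fun s c => by
        rw [op_smul, ← TensorProduct.smul_tmul, Algebra.smul_def, mul_one]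
        rw [← op_unop (op c), leftDual_map_tmul, leftDual_smul_apply, RingHom.id_apply,
          Algebra.smul_def] }
  refine ⟨n, LinearMap.pi fun ti =>
    { toFun := fun f => LinearMap.comp (regularDualCoord (k := k) ti.2) (ev ti.1 f)
      map_add' := fun f f' => ?_
      map_smul' := fun b f => ?_ }, ?_⟩
  · exact LinearMap.ext fun c => map_add (regularDualCoord (k := k) ti.2) _ _
  · refine LinearMap.ext fun c => congrArg (regularDualCoord (k := k) ti.2) ?_
    change f.1 ((1 ⊗ₜ[k] op b : EnvelopingAlgebra k Λ) •
      (1 ⊗ₜ[k] op c : EnvelopingAlgebra k Λ) • y ti.1) =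
        f.1 ((1 ⊗ₜ[k] op (c * b) : EnvelopingAlgebra k Λ) • y ti.1)
    rw [smul_smul]
    simp
  · refine (injective_iff_map_eq_zero _).2 fun f hf => ?_
    have hev (t : Fin n) (c : Λ) : ev t f c = 0 := by
      rw [← sum_regularDualCoord_mul (k := k) (ev t f c)]
      refine Finset.sum_eq_zero fun i _ => ?_
      have := congrArg (fun F : regularDual k Λ => (F c : Λ)) (congrFun hf (t, i))
      exact (congrArg (· * _) this).trans (zero_mul _)
    have hy (t : Fin n) (x : EnvelopingAlgebra k Λ) : f.1 (x • y t) = 0 := by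
      induction x using TensorProduct.induction_on with
      | zero => exact (congrArg f.1 (zero_smul (EnvelopingAlgebra k Λ) _)).trans (map_zero _)
      | tmul a b =>
        rw [← op_unop b, leftDual_map_tmul]
        exact (congrArg (a * ·) (hev t b.unop)).trans (mul_zero a)
      | add x x' hx hx' => rw [add_smul, map_add, hx, hx', add_zero]
    refine leftDual_ext fun x => ?_
    obtain ⟨z, rfl⟩ := hr x
    rw [← Finset.univ_sum_single z, map_sum, map_sum]
    refine Finset.sum_eq_zero fun t _ => ?_
    have hz : Pi.single t (z t) = z t • (Pi.single t 1 : Fin n → EnvelopingAlgebra k Λ) := by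
      refine funext fun j => ?_
      change _ = z t * (Pi.single t 1 : Fin n → EnvelopingAlgebra k Λ) j
      rw [Pi.single_apply, Pi.single_apply, mul_ite, mul_one, mul_zero]
    rw [hz, r.map_smul]
    exact hy t (z t)

end RegularDual

/-! ### Left splitting -/

section LeftProjective

open MulOpposite

variable (k : Type v) [Field k] (Λ : Type u) [Ring Λ] [Algebra k Λ]

/-- A bimodule is left projective if every surjection of bimodules onto it has a section which is
linear for the left action of `Λ`. -/
def IsLeftProjective (K : Type u) [AddCommGroup K] [Module (EnvelopingAlgebra k Λ) K] : Prop :=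
  ∀ (Y : ModuleCat.{u} (EnvelopingAlgebra k Λ)) (π : Y →ₗ[EnvelopingAlgebra k Λ] K),
    Function.Surjective π → ∃ s : K →+ Y, (∀ x, π (s x) = x) ∧
      ∀ (a : Λ) x, s ((a ⊗ₜ[k] 1 : EnvelopingAlgebra k Λ) • x) =
        (a ⊗ₜ[k] 1 : EnvelopingAlgebra k Λ) • s x

theorem isLeftProjective_regular : letI := regularBimodule k Λ; IsLeftProjective k Λ Λ := by
  let _ := regularBimodule k Λ
  intro Y π hπ
  obtain ⟨y, hy⟩ := hπ 1
  refine ⟨AddMonoidHom.mk' (fun x => (x ⊗ₜ[k] 1 : EnvelopingAlgebra k Λ) • y) fun a b => ?_,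
    fun x => ?_, fun a x => ?_⟩
  · rw [TensorProduct.add_tmul, add_smul]
  · change π ((x ⊗ₜ[k] 1 : EnvelopingAlgebra k Λ) • y) = x
    rw [map_smul, hy, regularBimodule_tmul_one_smul, mul_one]
  · rw [regularBimodule_tmul_one_smul]
    change ((a * x) ⊗ₜ[k] 1 : EnvelopingAlgebra k Λ) • y =
      _ • (x ⊗ₜ[k] 1 : EnvelopingAlgebra k Λ) • y
    rw [smul_smul]
    simp

/-- Projective bimodules have the lifting property for left linear maps. -/
theorem exists_left_lift {P : Type u} [AddCommGroup P] [Module (EnvelopingAlgebra k Λ) P]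
    [Module.Projective (EnvelopingAlgebra k Λ) P] {Y Z : Type u} [AddCommGroup Y]
    [Module (EnvelopingAlgebra k Λ) Y] [AddCommGroup Z] [Module (EnvelopingAlgebra k Λ) Z]
    (π : Y →ₗ[EnvelopingAlgebra k Λ] Z) (hπ : Function.Surjective π) (h : P →+ Z)
    (hh : ∀ (a : Λ) x, h ((a ⊗ₜ[k] 1 : EnvelopingAlgebra k Λ) • x) =
      (a ⊗ₜ[k] 1 : EnvelopingAlgebra k Λ) • h x) :
    ∃ t : P →+ Y, (∀ x, π (t x) = h x) ∧
      ∀ (a : Λ) x, t ((a ⊗ₜ[k] 1 : EnvelopingAlgebra k Λ) • x) =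
        (a ⊗ₜ[k] 1 : EnvelopingAlgebra k Λ) • t x := by
  let ℓ : Λ →+* EnvelopingAlgebra k Λ :=
    (Algebra.TensorProduct.includeLeft : Λ →ₐ[k] EnvelopingAlgebra k Λ).toRingHom
  let _ : Module Λ P := Module.compHom P ℓ
  let _ : Module Λ Y := Module.compHom Y ℓ
  let _ : Module Λ Z := Module.compHom Z ℓ
  have : IsScalarTower Λ (EnvelopingAlgebra k Λ) P := ⟨fun a x p => by
    change (a • x) • p = ℓ a • x • p
    rw [smul_smul]
    congr 1
    induction x using TensorProduct.induction_on with
    | zero => rw [smul_zero, mul_zero]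
    | tmul b c =>
      change (a * b) ⊗ₜ[k] c = a ⊗ₜ[k] 1 * b ⊗ₜ[k] c
      simp
    | add x y hx hy => rw [smul_add, mul_add, hx, hy]⟩
  -- `P` is a direct summand of a free bimodule, which is free as a left module.
  have : Module.Projective Λ P := by
    obtain ⟨s, hs⟩ := Module.projective_lifting_property
      (Finsupp.linearCombination (EnvelopingAlgebra k Λ) (id : P → P)) LinearMap.id
      (fun x => ⟨Finsupp.single x 1, by simp⟩)
    refine .of_split (s.restrictScalars Λ)
      ((Finsupp.linearCombination (EnvelopingAlgebra k Λ) (id : P → P)).restrictScalars Λ) ?_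
    ext x
    exact LinearMap.congr_fun hs x
  let π' : Y →ₗ[Λ] Z := { π.toAddMonoidHom with map_smul' := fun a x => π.map_smul (ℓ a) x }
  let h' : P →ₗ[Λ] Z := { h with map_smul' := hh }
  obtain ⟨t, ht⟩ := Module.projective_lifting_property π' h' hπ
  exact ⟨t.toAddMonoidHom, LinearMap.congr_fun ht, t.map_smul⟩

end LeftProjective

/-! ### The injective coresolution of `Λ` given by bimodule syzygies -/

section Coresolution

open CategoryTheory MulOpposite

variable {k : Type v} [Field k] {Λ : Type u} [Ring Λ] [Algebra k Λ]

theorem IsLeftProjective.of_equiv {K K' : Type u} [AddCommGroup K]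
    [Module (EnvelopingAlgebra k Λ) K] [AddCommGroup K'] [Module (EnvelopingAlgebra k Λ) K']
    (hK : IsLeftProjective k Λ K) (e : K ≃ₗ[EnvelopingAlgebra k Λ] K') :
    IsLeftProjective k Λ K' := by
  intro Y π hπ
  obtain ⟨s, hs, hs'⟩ := hK Y (e.symm.toLinearMap ∘ₗ π) (e.symm.surjective.comp hπ)
  refine ⟨s.comp e.symm.toAddEquiv.toAddMonoidHom, fun x => ?_, fun a x => ?_⟩
  · exact e.symm.injective (hs (e.symm x))
  · exact (congrArg s (e.symm.map_smul _ x)).trans (hs' a (e.symm x))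

section ShortExact

variable {A B C : ModuleCat.{u} (EnvelopingAlgebra k Λ)} {f : A →ₗ[EnvelopingAlgebra k Λ] B}
  {g : B →ₗ[EnvelopingAlgebra k Λ] C}

/-- A left linear section of `g` yields a left linear retraction of `f`. -/
theorem IsShortExact.exists_left_retraction (h : IsShortExact f g) (hC : IsLeftProjective k Λ C) :
    ∃ r : B →+ A, (∀ x, r (f x) = x) ∧
      ∀ (a : Λ) x, r ((a ⊗ₜ[k] 1 : EnvelopingAlgebra k Λ) • x) =
        (a ⊗ₜ[k] 1 : EnvelopingAlgebra k Λ) • r x := by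
  obtain ⟨s, hs, hs'⟩ := hC B g h.surjective
  have hker (x : B) : ∃ y, f y = x - s (g x) :=
    (h.exact _).1 (by rw [map_sub, hs, sub_self])
  choose r hr using hker
  refine ⟨AddMonoidHom.mk' r fun x y => h.injective ?_, fun x => h.injective ?_,
    fun a x => h.injective ?_⟩
  · rw [hr, f.map_add, hr, hr, g.map_add, s.map_add]
    abel
  · exact (hr _).trans (by rw [h.exact.apply_apply_eq_zero, map_zero, sub_zero])
  · rw [f.map_smul]
    change f (r _) = _ • f (r x)
    rw [hr, hr, g.map_smul, hs', smul_sub]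

/-- Left duality is exact on short exact sequences ending in a left projective bimodule. -/
theorem IsShortExact.leftDual (h : IsShortExact f g) (hC : IsLeftProjective k Λ C) :
    IsShortExact (leftDualMap g) (leftDualMap f) where
  injective φ ψ hφ := leftDual_ext fun x => by
    obtain ⟨y, rfl⟩ := h.surjective x
    exact congrArg (fun χ => χ.1 y) hφ
  exact φ := by
    constructor
    · intro hφ
      obtain ⟨s, hs, hs'⟩ := hC B g h.surjective
      refine ⟨⟨φ.1.comp s, fun a x => ?_⟩, leftDual_ext fun x => ?_⟩
      · simp only [AddMonoidHom.comp_apply]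
        rw [hs', leftDual_map_smul]
      · obtain ⟨y, hy⟩ := (h.exact (x - s (g x))).1 (by rw [map_sub, hs, sub_self])
        have : φ.1 (x - s (g x)) = 0 := by
          rw [← hy]
          exact congrArg (fun χ => χ.1 y) hφ
        rw [map_sub, sub_eq_zero] at this
        exact this.symm
    · rintro ⟨ψ, rfl⟩
      refine leftDual_ext fun x => ?_
      rw [leftDualMap_apply, leftDualMap_apply, h.exact.apply_apply_eq_zero, map_zero]
      rfl
  surjective φ := by
    obtain ⟨r, hr, hr'⟩ := h.exists_left_retraction hC
    refine ⟨⟨φ.1.comp r, fun a x => ?_⟩, leftDual_ext fun x => congrArg φ.1 (hr x)⟩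
    simp only [AddMonoidHom.comp_apply]
    rw [hr', leftDual_map_smul]

end ShortExact

variable {M N : ModuleCat.{u} (EnvelopingAlgebra k Λ)}

/-- Syzygies of left projective bimodules are left projective. -/
theorem IsWeakSyzygy.isLeftProjective (h : IsWeakSyzygy M N) (hM : IsLeftProjective k Λ M) :
    IsLeftProjective k Λ N := by
  obtain ⟨P, f, g, _, _, hs⟩ := h
  obtain ⟨r, hr, hr'⟩ := hs.exists_left_retraction hM
  intro Y π hπ
  obtain ⟨t, ht, ht'⟩ := exists_left_lift k Λ π hπ r hr'
  refine ⟨t.comp f.toAddMonoidHom, fun x => (ht (f x)).trans (hr x), fun a x => ?_⟩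
  exact (congrArg t (f.map_smul _ x)).trans (ht' a (f x))

/-- The comparison of extension problems: by adjunction, extending bimodule maps from the syzygy `N`
to `Λᵉ = Hom_k(D(Λ), Λ)` amounts to lifting maps from `D(Λ)` to the left dual of `N`. -/
theorem IsWeakSyzygy.ext_one_iff [FiniteDimensional k Λ] (h : IsWeakSyzygy M N)
    (hM : IsLeftProjective k Λ M) :
    Subsingleton (Abelian.Ext.{u} M
      (ModuleCat.of (EnvelopingAlgebra k Λ) (EnvelopingAlgebra k Λ)) 1) ↔
    Subsingleton (Abelian.Ext.{u} (ModuleCat.of Λ (regularDual k Λ))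
      (ModuleCat.of Λ (leftDual k Λ M)) 1) := by
  obtain ⟨P, f, g, _, hP, hs⟩ := h
  let e := envelopingEquivScalarHom (k := k) (Λ := Λ)
  have hd := hs.leftDual hM
  constructor
  · intro hExt
    refine hd.ext_one_of_lift (A := ModuleCat.of Λ (leftDual k Λ M))
      (B := ModuleCat.of Λ (leftDual k Λ P)) (C := ModuleCat.of Λ (leftDual k Λ N))
      (X := ModuleCat.of Λ (regularDual k Λ))
      (ext_subsingleton_of_injective (leftDual_injective P) one_pos) fun φ => ?_
    obtain ⟨ψ, hψ⟩ := hs.exists_extension hExt (e.symm.toLinearMap ∘ₗ toScalarHom φ)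
    refine ⟨ofScalarHom (e.toLinearMap ∘ₗ ψ), ?_⟩
    refine LinearMap.ext fun m => leftDual_ext fun x => ?_
    have := congrArg e (LinearMap.congr_fun hψ x)
    exact congrArg (fun F => F m) (this.trans (e.apply_symm_apply _))
  · intro hExt
    refine hs.ext_one_of_extension (ext_subsingleton_of_projective hP one_pos) fun φ => ?_
    obtain ⟨ψ, hψ⟩ := hd.exists_lift (A := ModuleCat.of Λ (leftDual k Λ M))
      (B := ModuleCat.of Λ (leftDual k Λ P)) (C := ModuleCat.of Λ (leftDual k Λ N))
      (X := ModuleCat.of Λ (regularDual k Λ)) hExt (ofScalarHom (e.toLinearMap ∘ₗ φ))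
    refine ⟨e.symm.toLinearMap ∘ₗ toScalarHom ψ, LinearMap.ext fun x => ?_⟩
    rw [← e.symm_apply_apply (φ x)]
    refine congrArg e.symm (scalarHom_ext fun m => ?_)
    exact congrArg (fun F : leftDual k Λ N => F.1 x) (LinearMap.congr_fun hψ m)

theorem Module.Injective.of_retract {I Q : Type u} [AddCommGroup I] [Module Λ I] [AddCommGroup Q]
    [Module Λ Q] (hI : Module.Injective Λ I) (s : Q →ₗ[Λ] I) (r : I →ₗ[Λ] Q)
    (hrs : r ∘ₗ s = LinearMap.id) : Module.Injective Λ Q := by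
  refine ⟨fun X Y _ _ _ _ f hf g => ?_⟩
  obtain ⟨t, ht⟩ := hI.out f hf (s ∘ₗ g)
  refine ⟨r ∘ₗ t, fun x => ?_⟩
  rw [LinearMap.comp_apply, ht]
  exact LinearMap.congr_fun hrs (g x)

/-- `Ext` vanishing for `D(Λ)` implies `Ext` vanishing for every injective left dual of a finitely
generated bimodule, as these are direct summands of powers of `D(Λ)`. -/
theorem ext_leftDual_of_regularDual [FiniteDimensional k Λ] (K : Type u) [AddCommGroup K]
    [Module (EnvelopingAlgebra k Λ) K] [Module.Finite (EnvelopingAlgebra k Λ) K]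
    (hK : Module.Injective Λ (leftDual k Λ K)) {Y : ModuleCat.{u} Λ} {i : ℕ}
    (h : Subsingleton (Abelian.Ext.{u} (ModuleCat.of Λ (regularDual k Λ)) Y i)) :
    Subsingleton (Abelian.Ext.{u} (ModuleCat.of Λ (leftDual k Λ K)) Y i) := by
  obtain ⟨n, s, hs⟩ := exists_leftDual_embedding (k := k) (Λ := Λ) K
  obtain ⟨r, hr⟩ := hK.out s hs LinearMap.id
  exact ext_subsingleton_of_retract (X := ModuleCat.of Λ (leftDual k Λ K))
    (X' := ModuleCat.of Λ (Fin n × Fin (Module.finrank k Λ) → regularDual k Λ)) s r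
    (LinearMap.ext hr) (ext_subsingleton_pi (X := ModuleCat.of Λ (regularDual k Λ)) h)

section Sequence

variable {X : ℕ → ModuleCat.{u} (EnvelopingAlgebra k Λ)}
  (hX : ∀ j, IsWeakSyzygy (X j) (X (j + 1))) (hX₀ : IsLeftProjective k Λ (X 0))

include hX hX₀

theorem isLeftProjective_syzygy (j : ℕ) : IsLeftProjective k Λ (X j) := by
  induction j with
  | zero => exact hX₀
  | succ j ih => exact (hX j).isLeftProjective ih

/-- Dimension shifting along the coresolution by left duals. -/
theorem ext_leftDual_syzygy_iff {Y : ModuleCat.{u} Λ} (j i : ℕ) (hi : 0 < i) :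
    Subsingleton (Abelian.Ext.{u} Y (ModuleCat.of Λ (leftDual k Λ (X j))) i) ↔
      Subsingleton (Abelian.Ext.{u} Y (ModuleCat.of Λ (leftDual k Λ (X 0))) (j + i)) := by
  induction j generalizing i with
  | zero => rw [zero_add]
  | succ j ih =>
    obtain ⟨P, f, g, _, _, hs⟩ := hX j
    have hd := hs.leftDual (isLeftProjective_syzygy hX hX₀ j)
    have hP (i : ℕ) (hi : 0 < i) :=
      ext_subsingleton_of_injective (X := Y) (I := ModuleCat.of Λ (leftDual k Λ P))
        (leftDual_injective P) hi
    rw [show j + 1 + i = j + (i + 1) by ring, ← ih (i + 1) i.succ_pos]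
    exact ⟨fun h => hd.ext_left_of_right (A := ModuleCat.of Λ (leftDual k Λ (X j)))
        (B := ModuleCat.of Λ (leftDual k Λ P)) (C := ModuleCat.of Λ (leftDual k Λ (X (j + 1))))
        (hP _ i.succ_pos) h,
      fun h => hd.ext_right_of_left (A := ModuleCat.of Λ (leftDual k Λ (X j)))
        (B := ModuleCat.of Λ (leftDual k Λ P)) (C := ModuleCat.of Λ (leftDual k Λ (X (j + 1))))
        (hP _ hi) h⟩

/-- For a bimodule `X 0` that is left projective, `Ext_{Λᵉ}^i(X 0, Λᵉ)` vanishes if and only if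
`Ext_Λ^i(D(Λ), Hom_Λ(X 0, Λ))` does. -/
theorem ext_enveloping_iff [FiniteDimensional k Λ] (i : ℕ) (hi : 0 < i) :
    Subsingleton (Abelian.Ext.{u} (X 0)
      (ModuleCat.of (EnvelopingAlgebra k Λ) (EnvelopingAlgebra k Λ)) i) ↔
    Subsingleton (Abelian.Ext.{u} (ModuleCat.of Λ (regularDual k Λ))
      (ModuleCat.of Λ (leftDual k Λ (X 0))) i) := by
  obtain ⟨j, rfl⟩ : ∃ j, i = j + 1 := ⟨i - 1, by omega⟩
  rw [← ext_subsingleton_syzygy_iff hX j 1 one_pos, ← ext_leftDual_syzygy_iff hX hX₀ j 1 one_pos]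
  exact (hX j).ext_one_iff (isLeftProjective_syzygy hX hX₀ j)

/-- If `Ext¹` between two consecutive terms of the coresolution vanishes, then both are direct
summands of the injective module between them. -/
theorem leftDual_injective_of_ext (j : ℕ)
    (h : Subsingleton (Abelian.Ext.{u} (ModuleCat.of Λ (leftDual k Λ (X (j + 1))))
      (ModuleCat.of Λ (leftDual k Λ (X j))) 1)) :
    Module.Injective Λ (leftDual k Λ (X j)) ∧ Module.Injective Λ (leftDual k Λ (X (j + 1))) := by
  obtain ⟨P, f, g, _, _, hs⟩ := hX j
  have hd := hs.leftDual (isLeftProjective_syzygy hX hX₀ j)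
  have hP := leftDual_injective (k := k) (Λ := Λ) P
  constructor
  · obtain ⟨r, hr⟩ := hd.exists_extension (A := ModuleCat.of Λ (leftDual k Λ (X j)))
      (B := ModuleCat.of Λ (leftDual k Λ P)) (C := ModuleCat.of Λ (leftDual k Λ (X (j + 1))))
      (Y := ModuleCat.of Λ (leftDual k Λ (X j))) h LinearMap.id
    exact hP.of_retract _ r hr
  · obtain ⟨s, hs⟩ := hd.exists_lift (A := ModuleCat.of Λ (leftDual k Λ (X j)))
      (B := ModuleCat.of Λ (leftDual k Λ P)) (C := ModuleCat.of Λ (leftDual k Λ (X (j + 1))))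
      (X := ModuleCat.of Λ (leftDual k Λ (X (j + 1)))) h LinearMap.id
    exact hP.of_retract s _ hs

/-- The injective dimension is read off from the injective coresolution by left duals. -/
theorem hasInjectiveDimensionLT_iff_leftDual_injective (j : ℕ) :
    HasInjectiveDimensionLT (ModuleCat.of Λ (leftDual k Λ (X 0))) (j + 1) ↔
      Module.Injective Λ (leftDual k Λ (X j)) := by
  have key (m : ℕ) : HasInjectiveDimensionLT (ModuleCat.of Λ (leftDual k Λ (X 0))) (j + m + 1) ↔
      HasInjectiveDimensionLT (ModuleCat.of Λ (leftDual k Λ (X j))) (m + 1) := by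
    induction j generalizing m with
    | zero => rw [zero_add]
    | succ j ih =>
      obtain ⟨P, f, g, _, _, hs⟩ := hX j
      have hd := (hs.leftDual (isLeftProjective_syzygy hX hX₀ j)).shortExact
        (A := ModuleCat.of Λ (leftDual k Λ (X j)))
        (B := ModuleCat.of Λ (leftDual k Λ P)) (C := ModuleCat.of Λ (leftDual k Λ (X (j + 1))))
      have hP : Injective (ModuleCat.of Λ (leftDual k Λ P)) :=
        (Module.injective_iff_injective_object Λ _).1 (leftDual_injective P)
      rw [show j + 1 + m + 1 = j + (m + 1) + 1 by ring, ih]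
      exact (hd.hasInjectiveDimensionLT_X₃_iff m hP).symm
  refine (key 0).trans ?_
  rw [zero_add, ← injective_iff_hasInjectiveDimensionLT_one]
  exact (Module.injective_iff_injective_object Λ _).symm

variable [FiniteDimensional k Λ] {g : ℕ}
  (hext : ∀ i, g < i → Subsingleton (Abelian.Ext.{u} (X 0)
    (ModuleCat.of (EnvelopingAlgebra k Λ) (EnvelopingAlgebra k Λ)) i))

include hext

/-- If some term of the coresolution is injective, then already its `g`-th term is, where
`Ext_{Λᵉ}^i(X 0, Λᵉ) = 0` for `i > g`: each of the sequences in between splits. -/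
theorem leftDual_injective_of_ext_vanishing
    (hfin : Module.Finite (EnvelopingAlgebra k Λ) (X 0)) {d : ℕ}
    (hd : Module.Injective Λ (leftDual k Λ (X (g + d)))) :
    Module.Injective Λ (leftDual k Λ (X g)) := by
  have : IsNoetherianRing (EnvelopingAlgebra k Λ) := IsNoetherianRing.of_finite k _
  induction d with
  | zero => exact hd
  | succ d ih =>
    have := syzygySequence_finite hX hfin (g + d + 1)
    refine ih (leftDual_injective_of_ext hX hX₀ (g + d) ?_).1
    refine ext_leftDual_of_regularDual _ hd ?_
    rw [ext_leftDual_syzygy_iff hX hX₀ _ 1 one_pos, ← ext_enveloping_iff hX hX₀ _ (by omega)]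
    exact hext _ (by omega)

/-- Dimension shifting in the first variable, starting from the projective module
`Hom_Λ(X 0, Λ)`. -/
theorem ext_leftDual_leftDual_vanishing
    (hproj : Module.Projective Λ (leftDual k Λ (X 0))) (j i : ℕ) (hi : g + j < i) :
    Subsingleton (Abelian.Ext.{u} (ModuleCat.of Λ (leftDual k Λ (X j)))
      (ModuleCat.of Λ (leftDual k Λ (X 0))) i) := by
  induction j generalizing i with
  | zero =>
    exact ext_subsingleton_of_projective (P := ModuleCat.of Λ (leftDual k Λ (X 0))) hproj
      (by omega)
  | succ j ih =>
    obtain ⟨P, f, f', _, _, hs⟩ := hX j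
    have hd := hs.leftDual (isLeftProjective_syzygy hX hX₀ j)
    obtain ⟨i, rfl⟩ : ∃ t, i = t + 1 := ⟨i - 1, by omega⟩
    refine hd.ext_right (A := ModuleCat.of Λ (leftDual k Λ (X j)))
      (B := ModuleCat.of Λ (leftDual k Λ P)) (C := ModuleCat.of Λ (leftDual k Λ (X (j + 1))))
      (ext_leftDual_of_regularDual P (leftDual_injective P) ?_) (ih i (by omega))
    rw [← ext_enveloping_iff hX hX₀ _ (by omega)]
    exact hext _ (by omega)

/-- If `Ext_{Λᵉ}(X 0, Λᵉ)` vanishes in high degrees and the syzygies are eventually periodic, then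
some term of the coresolution by left duals is injective. Indeed, `X n` recurs as `X (n + m)` for
arbitrarily large `m`, and the vanishing of `Ext^(n + m)(C n, C 0)` for the left duals `C j` then
means that `Ext¹(C (n + m), C (n + m - 1)) = 0`. -/
theorem exists_leftDual_injective (hproj : Module.Projective Λ (leftDual k Λ (X 0))) {n p : ℕ}
    (hp : 0 < p)
    (hper : ∀ j, n ≤ j → Nonempty (X (j + p) ≃ₗ[EnvelopingAlgebra k Λ] X j)) :
    ∃ j, Module.Injective Λ (leftDual k Λ (X j)) := by
  obtain ⟨e⟩ := exists_periodic_iso hper le_rfl (g + 1)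
  have hlt : g < (g + 1) * p := Nat.lt_of_lt_of_le g.lt_succ_self (Nat.le_mul_of_pos_right _ hp)
  have h : Subsingleton (Abelian.Ext.{u}
      (ModuleCat.of Λ (leftDual k Λ (X (n + (g + 1) * p))))
      (ModuleCat.of Λ (leftDual k Λ (X 0))) (n + (g + 1) * p)) :=
    ext_subsingleton_congr (X := ModuleCat.of Λ (leftDual k Λ (X (n + (g + 1) * p))))
      (X' := ModuleCat.of Λ (leftDual k Λ (X n))) (leftDualEquiv e).symm
      (ext_leftDual_leftDual_vanishing hX hX₀ hext hproj n _ (by omega))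
  obtain ⟨j, hj⟩ : ∃ j, n + (g + 1) * p = j + 1 := ⟨n + (g + 1) * p - 1, by omega⟩
  rw [hj] at h
  exact ⟨j + 1, (leftDual_injective_of_ext hX hX₀ j
    ((ext_leftDual_syzygy_iff hX hX₀ j 1 one_pos).2 h)).2⟩

end Sequence

end Coresolution

/-! ### Resolutions by totally reflexive modules -/

section GorensteinDimension

open CategoryTheory

variable {R : Type u} [Ring R]

/-- A resolution of length `n` by totally reflexive modules forces `Ext^i(M, R) = 0` for `i > n`. -/
theorem HasTotallyReflexiveResolution.ext_subsingleton {n : ℕ} (M : ModuleCat.{u} R)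
    (h : HasTotallyReflexiveResolution R M n) (i : ℕ) (hi : n < i) :
    Subsingleton (Abelian.Ext.{u} M (ModuleCat.of R R) i) := by
  induction n generalizing M i with
  | zero =>
    obtain ⟨X, d, ε, hX, hz, hε, hdε, -⟩ := h
    have := hz 1 one_pos
    have hinj : Function.Injective ε := (injective_iff_map_eq_zero _).2 fun x hx => by
      obtain ⟨y, rfl⟩ := (hdε x).1 hx
      rw [Subsingleton.elim y 0, map_zero]
    exact ext_subsingleton_congr (LinearEquiv.ofBijective ε ⟨hinj, hε⟩).symm
      ((hX 0).ext_eq_zero i hi)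
  | succ n ih =>
    obtain ⟨X, d, ε, hX, hz, hε, hdε, hd⟩ := h
    have hs : IsShortExact (LinearMap.ker ε).subtype ε :=
      ⟨Subtype.val_injective, LinearMap.exact_subtype_ker_map ε, hε⟩
    obtain ⟨i, rfl⟩ : ∃ t, i = t + 1 := ⟨i - 1, by omega⟩
    refine hs.ext_right (A := ModuleCat.of R (LinearMap.ker ε)) ((hX 0).ext_eq_zero _ i.succ_pos)
      (ih (ModuleCat.of R (LinearMap.ker ε)) ?_ i (by omega))
    refine ⟨fun i => X (i + 1), fun i => d (i + 1),
      (d 0).codRestrict (LinearMap.ker ε) fun x => (hdε _).2 ⟨x, rfl⟩, fun i => hX _,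
      fun i hi => hz _ (by omega), fun x => ?_, fun x => ?_, fun i => hd _⟩
    · obtain ⟨y, hy⟩ := (hdε x).1 x.2
      exact ⟨y, Subtype.ext hy⟩
    · rw [← hd 0 x]
      exact Subtype.ext_iff

theorem IsTotallyReflexive.hasTotallyReflexiveResolution_zero {M : ModuleCat.{u} R}
    (h : IsTotallyReflexive R M) : HasTotallyReflexiveResolution R M 0 := by
  have hz : IsTotallyReflexive R (ModuleCat.of R PUnit.{u + 1}) := .of_projective _
  refine ⟨fun i => Nat.casesOn i M fun _ => ModuleCat.of R PUnit.{u + 1}, fun i => 0, LinearMap.id,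
    fun i => ?_, fun i hi => ?_, Function.surjective_id, fun x => ?_, fun i x => ?_⟩
  · cases i with
    | zero => exact h
    | succ i => exact hz
  · cases i with
    | zero => exact absurd hi (lt_irrefl 0)
    | succ i => exact inferInstanceAs (Subsingleton PUnit.{u + 1})
  · exact ⟨fun hx => ⟨PUnit.unit, hx.symm⟩, fun ⟨_, hy⟩ => hy.symm⟩
  · exact ⟨fun _ => ⟨PUnit.unit, rfl⟩, fun _ => rfl⟩

/-- A resolution of a syzygy of `M` is prolonged by a projective module to one of `M`. -/
theorem HasTotallyReflexiveResolution.succ {M N : ModuleCat.{u} R} {n : ℕ}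
    (hN : HasTotallyReflexiveResolution R N n) (h : IsWeakSyzygy M N) :
    HasTotallyReflexiveResolution R M (n + 1) := by
  obtain ⟨P, f, g, _, _, hs⟩ := h
  obtain ⟨X, d, ε, hX, hz, hε, hdε, hd⟩ := hN
  refine ⟨fun i => Nat.casesOn i P X, fun i => match i with
    | 0 => f ∘ₗ ε
    | i + 1 => d i, g, fun i => ?_, fun i hi => ?_, hs.surjective, fun x => ?_, fun i => ?_⟩
  · cases i with
    | zero => exact .of_projective P
    | succ i => exact hX i
  · cases i with
    | zero => exact absurd hi (Nat.not_lt_zero _)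
    | succ i => exact hz i (by omega)
  · rw [hs.exact x]
    exact ⟨fun ⟨y, hy⟩ => (hε y).imp fun z hz => (congrArg f hz).trans hy,
      fun ⟨z, hz⟩ => ⟨ε z, hz⟩⟩
  · cases i with
    | zero =>
      intro x
      refine Iff.trans ?_ (hdε x)
      exact ⟨fun hx => hs.injective (hx.trans (map_zero f).symm), fun hx => by
        change f (ε x) = 0
        rw [hx, map_zero]⟩
    | succ i => exact hd i

theorem HasTotallyReflexiveResolution.congr {M M' : Type u} [AddCommGroup M] [Module R M]
    [AddCommGroup M'] [Module R M'] {n : ℕ} (h : HasTotallyReflexiveResolution R M n)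
    (e : M ≃ₗ[R] M') : HasTotallyReflexiveResolution R M' n := by
  obtain ⟨X, d, ε, hX, hz, hε, hdε, hd⟩ := h
  refine ⟨X, d, e.toLinearMap ∘ₗ ε, hX, hz, e.surjective.comp hε, fun x => ?_, hd⟩
  rw [← hdε x]
  exact e.map_eq_zero_iff

theorem hasTotallyReflexiveResolution_of_syzygy {X : ℕ → ModuleCat.{u} R}
    (hX : ∀ j, IsWeakSyzygy (X j) (X (j + 1))) (d : ℕ) (hd : IsTotallyReflexive R (X d)) :
    HasTotallyReflexiveResolution R (X 0) d := by
  have key (t s : ℕ) (h : s + t = d) : HasTotallyReflexiveResolution R (X s) t := by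
    induction t generalizing s with
    | zero =>
      obtain rfl : s = d := h
      exact hd.hasTotallyReflexiveResolution_zero
    | succ t ih => exact (ih (s + 1) (by omega)).succ (hX s)
  exact key d 0 (zero_add d)

theorem gorensteinDim_lt_top_iff (M : Type u) [AddCommGroup M] [Module R M] :
    gorensteinDim R M < ⊤ ↔ ∃ n, HasTotallyReflexiveResolution R M n := by
  simp [gorensteinDim, iInf_lt_iff]

theorem injDim_le_iff (M : Type u) [AddCommGroup M] [Module R M] (d : ℕ) :
    injDim R M ≤ d ↔ HasInjectiveDimensionLT (ModuleCat.of R M) (d + 1) := by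
  rw [show HasInjectiveDimensionLT (ModuleCat.of R M) (d + 1) ↔
    HasInjectiveDimensionLE (ModuleCat.of R M) d from Iff.rfl, ← injectiveDimension_le_iff, injDim]
  induction injectiveDimension (ModuleCat.of R M) with
  | bot => simp
  | coe x => exact WithBot.coe_le_coe.symm

theorem injDim_lt_top_iff (M : Type u) [AddCommGroup M] [Module R M] :
    injDim R M < ⊤ ↔ ∃ d : ℕ, HasInjectiveDimensionLT (ModuleCat.of R M) (d + 1) := by
  simp only [← injDim_le_iff]
  refine ⟨fun h => ?_, fun ⟨d, hd⟩ => hd.trans_lt (ENat.natCast_lt_top d)⟩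
  obtain ⟨d, hd⟩ := ENat.ne_top_iff_exists.1 h.ne
  exact ⟨d, hd.ge⟩

end GorensteinDimension

/-! ### Eventually periodic algebras -/

section EventuallyPeriodic

open CategoryTheory MulOpposite

variable (k : Type v) [Field k] (Λ : Type u) [Ring Λ] [Algebra k Λ]

theorem regularBimodule_finite :
    letI := regularBimodule k Λ; Module.Finite (EnvelopingAlgebra k Λ) Λ := by
  let _ := regularBimodule k Λ
  refine .of_surjective (LinearMap.toSpanSingleton (EnvelopingAlgebra k Λ) Λ 1) fun x =>
    ⟨x ⊗ₜ[k] 1, ?_⟩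
  exact (regularBimodule_tmul_one_smul x 1).trans (mul_one x)

/-- The ring isomorphism between the enveloping algebras of `Λᵐᵒᵖ` and of `Λ` which exchanges the
two tensor factors. -/
noncomputable def envelopingOpEquiv :
    EnvelopingAlgebra k Λᵐᵒᵖ ≃+* EnvelopingAlgebra k Λ :=
  ((Algebra.TensorProduct.comm k Λᵐᵒᵖ Λᵐᵒᵖᵐᵒᵖ).trans
    (Algebra.TensorProduct.congr (AlgEquiv.opOp k Λ).symm AlgEquiv.refl)).toRingEquiv

variable {k Λ}

/-- Over the enveloping algebra of `Λᵐᵒᵖ`, the regular bimodule of `Λ` is that of `Λᵐᵒᵖ`. -/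
noncomputable def restrictRegularEquiv :
    letI := regularBimodule k Λ
    letI := regularBimodule k Λᵐᵒᵖ
    restrictRing (envelopingOpEquiv k Λ) (ModuleCat.of (EnvelopingAlgebra k Λ) Λ) ≃ₗ[
      EnvelopingAlgebra k Λᵐᵒᵖ] Λᵐᵒᵖ :=
  letI := regularBimodule k Λ
  letI := regularBimodule k Λᵐᵒᵖ
  let e : restrictRing (envelopingOpEquiv k Λ) (ModuleCat.of (EnvelopingAlgebra k Λ) Λ) ≃+ Λᵐᵒᵖ :=
    opAddEquiv
  { e with
    map_smul' := (envelopingLinearMap e.toAddMonoidHom fun a b x => by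
      change op ((b.unop ⊗ₜ[k] a : EnvelopingAlgebra k Λ) • (show Λ from x)) =
        (a ⊗ₜ[k] op b : EnvelopingAlgebra k Λᵐᵒᵖ) • op (show Λ from x)
      rw [regularBimodule_smul, ← op_unop a, regularBimodule_smul, mul_assoc]
      rfl).map_smul }

/-- If `Λ` is eventually periodic and `Ext_{Λᵉ}(Λ, Λᵉ)` vanishes in high degrees, then `Λ` has
finite injective dimension as a left module. -/
theorem hasInjectiveDimensionLT_of_ext_vanishing [FiniteDimensional k Λ]
    {X : ℕ → ModuleCat.{u} (EnvelopingAlgebra k Λ)}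
    (hX : ∀ j, IsWeakSyzygy (X j) (X (j + 1)))
    (e : letI := regularBimodule k Λ; X 0 ≃ₗ[EnvelopingAlgebra k Λ] Λ) {n p : ℕ} (hp : 0 < p)
    (hper : ∀ j, n ≤ j → Nonempty (X (j + p) ≃ₗ[EnvelopingAlgebra k Λ] X j)) {g : ℕ}
    (hext : ∀ i, g < i → Subsingleton (Abelian.Ext.{u} (X 0)
      (ModuleCat.of (EnvelopingAlgebra k Λ) (EnvelopingAlgebra k Λ)) i)) :
    ∃ d : ℕ, HasInjectiveDimensionLT (ModuleCat.of Λ Λ) (d + 1) := by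
  let _ := regularBimodule k Λ
  have hX₀ : IsLeftProjective k Λ (X 0) := (isLeftProjective_regular k Λ).of_equiv e.symm
  let i : leftDual k Λ (X 0) ≃ₗ[Λ] Λ := (leftDualEquiv e).symm.trans leftDualRegular
  have hproj : Module.Projective Λ (leftDual k Λ (X 0)) := .of_equiv' i.symm
  obtain ⟨d, hd⟩ := exists_leftDual_injective hX hX₀ hext hproj hp hper
  have := (hasInjectiveDimensionLT_iff_leftDual_injective hX hX₀ d).2 hd
  exact ⟨d, hasInjectiveDimensionLT_of_iso i.toModuleIso (d + 1)⟩

end EventuallyPeriodic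

theorem theorem5p7 (k : Type v) [Field k] (Λ : Type u) [Ring Λ] [Algebra k Λ]
    [FiniteDimensional k Λ] (hΛ : IsEventuallyPeriodicAlgebra k Λ) :
    (IsGorensteinRing Λ ↔ bimoduleGorensteinDim k Λ < ⊤) ∧
      (IsGorensteinRing Λ → bimoduleGorensteinDim k Λ = injDim Λ Λ) := by
  let _ := regularBimodule k Λ
  have hE : IsNoetherianRing (EnvelopingAlgebra k Λ) := IsNoetherianRing.of_finite k _
  have := regularBimodule_finite k Λ
  obtain ⟨X, n, p, hp, ⟨e⟩, hX, hper⟩ :=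
    IsEventuallyPeriodicModule.exists_syzygySequence (R := EnvelopingAlgebra k Λ) (M := Λ) hΛ
  have hfin : Module.Finite (EnvelopingAlgebra k Λ) (X 0) := .equiv e.symm
  have hX₀ : IsLeftProjective k Λ (X 0) := (isLeftProjective_regular k Λ).of_equiv e.symm
  let i : leftDual k Λ (X 0) ≃ₗ[Λ] Λ := (leftDualEquiv e).symm.trans leftDualRegular
  -- A totally reflexive resolution bounds the degrees in which `Ext_{Λᵉ}(Λ, Λᵉ)` lives.
  have hext (g : ℕ) (hg : HasTotallyReflexiveResolution (EnvelopingAlgebra k Λ) Λ g) (j : ℕ)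
      (hj : g < j) : Subsingleton (CategoryTheory.Abelian.Ext.{u} (X 0)
        (ModuleCat.of (EnvelopingAlgebra k Λ) (EnvelopingAlgebra k Λ)) j) :=
    HasTotallyReflexiveResolution.ext_subsingleton (X 0) (hg.congr e.symm) j hj
  have heq (hG : injDim Λ Λ < ⊤) : bimoduleGorensteinDim k Λ = injDim Λ Λ := by
    obtain ⟨d, hd⟩ := ENat.ne_top_iff_exists.1 hG.ne
    have hinj : CategoryTheory.HasInjectiveDimensionLT (ModuleCat.of Λ Λ) (d + 1) :=
      (injDim_le_iff Λ d).1 hd.ge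
    have hinj' := CategoryTheory.hasInjectiveDimensionLT_of_iso i.symm.toModuleIso (d + 1)
    refine le_antisymm ?_ (le_iInf₂ fun g hg => ?_)
    · rw [← hd]
      refine iInf₂_le d (HasTotallyReflexiveResolution.congr
        (hasTotallyReflexiveResolution_of_syzygy hX d ?_) e)
      refine isTotallyReflexive_syzygy hX hfin hp hper d fun j hj => ?_
      exact (ext_enveloping_iff hX hX₀ j (by omega)).2
        (CategoryTheory.HasInjectiveDimensionLT.subsingleton _ (d + 1) j hj _)
    · rw [injDim_le_iff]
      have hg' : Module.Injective Λ (leftDual k Λ (X g)) := by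
        refine leftDual_injective_of_ext_vanishing hX hX₀ (hext g hg) hfin (d := d) ?_
        rw [← hasInjectiveDimensionLT_iff_leftDual_injective hX hX₀]
        exact CategoryTheory.hasInjectiveDimensionLT_of_ge _ (d + 1) _ (by omega)
      have := (hasInjectiveDimensionLT_iff_leftDual_injective hX hX₀ g).2 hg'
      exact CategoryTheory.hasInjectiveDimensionLT_of_iso i.toModuleIso (g + 1)
  refine ⟨⟨fun hG => (heq hG.injDim_left).trans_lt hG.injDim_left, fun hG => ?_⟩,
    fun hG => heq hG.injDim_left⟩
  obtain ⟨g, hg⟩ := (gorensteinDim_lt_top_iff (R := EnvelopingAlgebra k Λ) Λ).1 hG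
  refine ⟨IsNoetherianRing.of_finite k Λ, IsNoetherianRing.of_finite k Λᵐᵒᵖ,
    (injDim_lt_top_iff Λ).2
      (hasInjectiveDimensionLT_of_ext_vanishing hX e hp hper (hext g hg)), ?_⟩
  -- The right hand side follows from the left hand side for `Λᵐᵒᵖ`, whose bimodules are those of
  -- `Λ` with the two actions exchanged.
  let _ := regularBimodule k Λᵐᵒᵖ
  have hX' (j : ℕ) : IsWeakSyzygy (restrictRing (envelopingOpEquiv k Λ) (X j))
    (restrictRing (envelopingOpEquiv k Λ) (X (j + 1))) := (hX j).restrictScalars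
  obtain ⟨d, hd⟩ := hasInjectiveDimensionLT_of_ext_vanishing (k := k) (Λ := Λᵐᵒᵖ) (g := g) hX'
    ((restrictRingEquiv e).trans restrictRegularEquiv) hp
    (fun j hj => (hper j hj).map restrictRingEquiv) fun j hj => by
      obtain ⟨j, rfl⟩ : ∃ t, j = t + 1 := ⟨j - 1, by omega⟩
      rw [← ext_subsingleton_syzygy_iff hX' j 1 one_pos]
      exact (hX j).ext_one_restrictRing
        ((ext_subsingleton_syzygy_iff hX j 1 one_pos).2 (hext g hg (j + 1) hj))
  let o : Λᵐᵒᵖ ≃ₗ[Λᵐᵒᵖ] Λ :=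
    { MulOpposite.opAddEquiv.symm with
      map_smul' := fun _ _ => rfl }
  exact (injDim_lt_top_iff Λ).2
    ⟨d, CategoryTheory.hasInjectiveDimensionLT_of_iso o.toModuleIso (d + 1)⟩
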